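/- Let $k$ be a field and let $Q$ be a quiver of type $\mathbb{A}_\infty$ or $\mathbb{A}_\infty^\infty$, that is, the underlying graph of $Q$ is the one-sided infinite line $\circ - \circ - \circ - \cdots$ or the two-sided infinite line $\cdots - \circ - \circ - \circ - \cdots$, with an arbitrary orientation. A representation $M$ of $Q$ over $k$ is *locally finite dimensional* if $\dim_k M(x) < \infty$ for every vertex $x$. For a vertex $a$, let $P_a$ be the representation for which $P_a(x)$ has as a basis the paths from $a$ to $x$, with arrows acting by composition. Let $\mathrm{proj}(Q)$ consist of the locally finite dimensional representations isomorphic to a finite direct sum of representations $P_a \otimes_k U$, with $a$ a vertex and $U$ a $k$-space. A representation $M$ is *finitely presented* if there is an exact sequence $0 \to P_1 \to P_0 \to M \to 0$ with $P_0, P_1 \in \mathrm{proj}(Q)$. A *walk* $w$ is a trivial walk at a vertex, or a nonempty, finite or (one-sided or two-sided) infinite product $\cdots c_{i+1} c_i \cdots$ of arrows and formal inverses of arrows such that $c_i$ ends where $c_{i+1}$ starts; it is *reduced* if always $c_{i+1} \neq c_i^{-1}$. Let $Q(w)$ be the full subquiver of $Q$ generated by the vertices appearing in $w$. A *string* is a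 reduced walk $w$ such that $Q(w)$ has at least one, and at most finitely many, vertices that are sinks or sources of $Q(w)$. We say that $w$ has *no left infinite path* if $Q(w)$ contains no infinite path $\cdots \to x_2 \to x_1 \to x_0$. The *string representation* $M(w)$ has $M(w)(x) = k$ if the vertex $x$ appears in $w$ and $M(w)(x) = 0$ otherwise; for an arrow $\alpha$, $M(w)(\alpha)$ is the identity of $k$ if $\alpha$ or $\alpha^{-1}$ appears in $w$, and $0$ otherwise. Let $M$ be an indecomposable locally finite dimensional representation of $Q$ over $k$. Then $M$ is finitely presented if and only if $M \cong M(w)$ for some string $w$ in $Q$ having no left infinite path. -/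

import Mathlib

open CategoryTheory

universe u v w

namespace QuiverRep

/-! ### Quivers with a prescribed underlying graph -/

/-- The underlying (multi)graph of the quiver `V` is the simple graph `G`, up to a bijection `e` on
vertices: exactly one arrow (in one of the two directions) between vertices that are adjacent
in `G`, and no arrow between other vertices (in particular no loops). -/
def HasUnderlyingGraph (V : Type u) [Quiver.{v} V] {I : Type} (G : SimpleGraph I) : Prop :=
  ∃ e : I ≃ V, ∀ i j : I,
    (G.Adj i j → Nat.card ((e i ⟶ e j) ⊕ (e j ⟶ e i)) = 1) ∧
    (¬ G.Adj i j → IsEmpty (e i ⟶ e j))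

/-- Type `A_∞`: the underlying graph is the one-sided infinite line `0 — 1 — 2 — ⋯`. -/
def IsTypeAInf (V : Type u) [Quiver.{v} V] : Prop :=
  HasUnderlyingGraph V (SimpleGraph.hasse ℕ)

/-- Type `A_∞^∞`: the underlying graph is the two-sided infinite line `⋯ — -1 — 0 — 1 — ⋯`. -/
def IsTypeAInfInf (V : Type u) [Quiver.{v} V] : Prop :=
  HasUnderlyingGraph V (SimpleGraph.hasse ℤ)

/-! ### Full subquivers, given by their sets of vertices -/

/-- `x` is a sink vertex of the full subquiver on `S`. -/
def IsSinkIn {V : Type u} [Quiver.{v} V] (S : Set V) (x : V) : Prop :=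
  x ∈ S ∧ ∀ y ∈ S, IsEmpty (x ⟶ y)

/-- `x` is a source vertex of the full subquiver on `S`. -/
def IsSourceIn {V : Type u} [Quiver.{v} V] (S : Set V) (x : V) : Prop :=
  x ∈ S ∧ ∀ y ∈ S, IsEmpty (y ⟶ x)

/-- The full subquiver on `S` contains a left infinite path, that is, an infinite path
`⋯ ⟶ x 2 ⟶ x 1 ⟶ x 0` with an ending point. -/
def HasLeftInfinitePath {V : Type u} [Quiver.{v} V] (S : Set V) : Prop :=
  ∃ x : ℕ → V, (∀ n, x n ∈ S) ∧ ∀ n, Nonempty (x (n + 1) ⟶ x n)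

/-! ### Walks and strings -/

/-- An edge of a quiver: an arrow, or the formal inverse of an arrow. -/
inductive Edge (V : Type u) [Quiver.{v} V] : Type (max u v)
  | arrow {x y : V} (α : x ⟶ y) : Edge V
  | inv {x y : V} (α : x ⟶ y) : Edge V

namespace Edge

variable {V : Type u} [Quiver.{v} V]

/-- The starting point of an edge. -/
def start : Edge V → V
  | @arrow _ _ x _ _ => x
  | @inv _ _ _ y _ => y

/-- The ending point of an edge. -/
def finish : Edge V → V
  | @arrow _ _ _ y _ => y
  | @inv _ _ x _ _ => x

/-- The inverse of an edge. -/
def inverse : Edge V → Edge V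
  | arrow α => inv α
  | inv α => arrow α

end Edge

/-- A walk: a trivial walk at a vertex, or a finite or infinite product `⋯ c (i + 1) c i ⋯` of
edges, indexed by a nonempty interval `I` of `ℤ`, where `c i` ends where `c (i + 1)` starts. -/
inductive Walk (V : Type u) [Quiver.{v} V] : Type (max u v)
  | trivial (x : V) : Walk V
  | nontrivial (I : Set ℤ) (nonempty : I.Nonempty) (interval : I.OrdConnected) (c : I → Edge V)
      (composable : ∀ i j : I, (j : ℤ) = i + 1 → (c i).finish = (c j).start) : Walk V

namespace Walk

variable {V : Type u} [Quiver.{v} V]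

/-- A walk is reduced if `c (i + 1)` is never the inverse of `c i`. -/
def IsReduced : Walk V → Prop
  | trivial _ => True
  | nontrivial I _ _ c _ => ∀ i j : I, (j : ℤ) = i + 1 → c j ≠ (c i).inverse

/-- The set of vertices that appear in a walk. The quiver `Q(w)` is the full subquiver on it. -/
def verts : Walk V → Set V
  | trivial x => {x}
  | nontrivial _ _ _ c _ => {x | ∃ i, x = (c i).start ∨ x = (c i).finish}

/-- The arrow `α` or its inverse appears in the walk. -/
def HasArrow : Walk V → ∀ {x y : V}, (x ⟶ y) → Prop
  | trivial _, _, _, _ => False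
  | nontrivial _ _ _ c _, _, _, α => ∃ i, c i = Edge.arrow α ∨ c i = Edge.inv α

/-- A string is a reduced walk `w` such that `Q(w)` has at least one, and at most finitely many,
sink or source vertices. -/
def IsString (p : Walk V) : Prop :=
  p.IsReduced ∧
    {x | IsSinkIn p.verts x ∨ IsSourceIn p.verts x}.Nonempty ∧
    {x | IsSinkIn p.verts x ∨ IsSourceIn p.verts x}.Finite

theorem HasArrow.target_mem {p : Walk V} {x y : V} {α : x ⟶ y} (h : p.HasArrow α) :
    y ∈ p.verts := by
  cases p with
  | trivial z => exact h.elim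
  | nontrivial I hI hI' c hc =>
    obtain ⟨i, hi | hi⟩ := h
    · exact ⟨i, Or.inr (by rw [hi]; rfl)⟩
    · exact ⟨i, Or.inl (by rw [hi]; rfl)⟩

end Walk

/-! ### Representations -/

/-- The category of `k`-representations of the quiver `V`: functors from its free (path) category,
that is, families of `k`-spaces indexed by the vertices and of `k`-maps indexed by the arrows. The
universe of the spaces is large enough for `k` and for the sets of paths. -/
abbrev Representation (k : Type w) [Field k] (V : Type u) [Quiver.{v} V] :=
  Paths V ⥤ ModuleCat.{max u v w} k

section

variable {k : Type w} [Field k] {V : Type u} [Quiver.{v} V]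

/-- `M(x)` has finite dimension for every vertex `x`. -/
def IsLocallyFiniteDimensional (M : Representation k V) : Prop :=
  ∀ x : V, FiniteDimensional k (M.obj ((Paths.of V).obj x))

/-- The representation `P_a ⊗ U`, where `P_a(x)` is the space with basis the paths from `a`
to `x`, and arrows act by composition of paths. -/
noncomputable def projTensor (a : V) (U : ModuleCat.{max u v w} k) : Representation k V where
  obj x := ModuleCat.of k (TensorProduct k (((Paths.of V).obj a ⟶ x) →₀ k) U)
  map f := ModuleCat.ofHom (LinearMap.rTensor U (Finsupp.lmapDomain k k (fun p => p ≫ f)))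
  map_id x := by
    ext : 1
    simp only [ModuleCat.hom_ofHom, ModuleCat.hom_id, Category.comp_id]
    exact (congrArg (LinearMap.rTensor U) (Finsupp.lmapDomain_id k k)).trans
      (LinearMap.rTensor_id U _)
  map_comp f g := by
    ext : 1
    simp only [ModuleCat.hom_ofHom, ModuleCat.hom_comp, ← LinearMap.rTensor_comp,
      ← Finsupp.lmapDomain_comp]
    congr 2
    funext p
    simp

/-- `Proj(Q)`: the finite direct sums (that is, coproducts) of representations `P_a ⊗ U`, up to
isomorphism. -/
def IsProj (P : Representation k V) : Prop :=
  ∃ (n : ℕ) (a : Fin n → V) (U : Fin n → ModuleCat.{max u v w} k),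
    Nonempty (P ≅ Limits.sigmaObj fun i => projTensor (a i) (U i))

/-- `M` is finitely presented: there is a short exact sequence `0 ⟶ P₁ ⟶ P₀ ⟶ M ⟶ 0` where `P₁`
and `P₀` are locally finite dimensional objects of `Proj(Q)`. -/
def IsFinitelyPresented (M : Representation k V) : Prop :=
  ∃ (P₁ P₀ : Representation k V) (f : P₁ ⟶ P₀) (g : P₀ ⟶ M) (h : f ≫ g = 0),
    (ShortComplex.mk f g h).ShortExact ∧
    IsProj P₁ ∧ IsLocallyFiniteDimensional P₁ ∧
    IsProj P₀ ∧ IsLocallyFiniteDimensional P₀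

end

section

variable (k : Type w) [Field k] {V : Type u} [Quiver.{v} V]

open scoped Classical in
/-- The space `M(p)(x)`: it is `k` (lifted to the universe in use) if `x` appears in the walk `p`,
and `0` otherwise. -/
noncomputable def stringSpace (p : Walk V) (x : V) : Submodule k (ULift.{max u v} k) :=
  if x ∈ p.verts then ⊤ else ⊥

theorem stringSpace_le {p : Walk V} {x y : V} {α : x ⟶ y} (h : p.HasArrow α) :
    stringSpace k p x ≤ stringSpace k p y := by
  have hy : stringSpace k p y = ⊤ := if_pos h.target_mem
  rw [hy]
  exact le_top

open scoped Classical in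
/-- The representation `M(p)` of a walk `p`: the spaces are `stringSpace`; an arrow acts as the
identity of `k` if it or its inverse appears in `p`, and as zero otherwise. -/
noncomputable def stringRep (p : Walk V) : Representation k V :=
  Paths.lift
    { obj := fun x => ModuleCat.of k (stringSpace k p x)
      map := fun {_ _} α =>
        if h : p.HasArrow α then ModuleCat.ofHom (Submodule.inclusion (stringSpace_le k h))
        else 0 }

end

end QuiverRep

/-! The vertices of `Q` sit on an interval of `ℤ` (`LinePos`), and any two vertices are joined by at
most one path in each direction. Hence `P_a` is the indicator representation `ind k (reach a)`, and
for a reduced walk `M(w)` is the indicator of an interval, every nonempty interval being obtained in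
this way (`nonempty_stringRep_iso`, `exists_walk`). The theorem becomes a statement about `ind k S`
for intervals `S`.

From strings to presentations: finitely presented representations are closed under extensions and
under quotients by locally finite dimensional projectives. Dividing `P_b` by its part on one side of
`b`, which is zero or some `P_b'`, gives rays and then simples. If `S` has finitely many sinks and
sources and no left infinite path, each unbounded end of `S` is eventually oriented outwards, so its
tail is such a ray; finitely many simples are glued on by extensions (`isFinitelyPresented_ind`).

From presentations to strings: far out in either direction, a finitely presented `M` has
isomorphisms along outward arrows and zero spaces at the starts of inward arrows (`IsStableFrom`).
This holds for `P_a ⊗ U` and passes to finite sums and cokernels of monomorphisms. A nonzero `M`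
with this property at both ends has some `ind k S`, with `S` a nonempty interval, as a direct
summand: vectors and functionals of pairing one are propagated along the line, with a pair of
subspaces `B < A` steering the choices until the stable range is reached
(`exists_isSplitting_of_lt`, `exists_isSplitting_univ`). Indecomposability yields `M ≅ ind k S`, and
stability of `ind k S` forces the conditions on `S`. -/

namespace QuiverRep

open Limits

/-! ### Presentations by a class of projective objects -/

section Presentation

variable {C : Type*} [Category C] [Abelian C]

/-- `X` is the cokernel of a monomorphism between objects satisfying `P`. -/
def IsPresentedBy (P : ObjectProperty C) (X : C) : Prop :=
  ∃ (P₁ P₀ : C) (f : P₁ ⟶ P₀) (g : P₀ ⟶ X) (h : f ≫ g = 0),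
    (ShortComplex.mk f g h).ShortExact ∧ P P₁ ∧ P P₀

theorem IsPresentedBy.of_iso {P : ObjectProperty C} {X Y : C} (e : X ≅ Y)
    (hX : IsPresentedBy P X) : IsPresentedBy P Y := by
  obtain ⟨P₁, P₀, f, g, h, hS, h₁, h₀⟩ := hX
  refine ⟨P₁, P₀, f, g ≫ e.hom, by rw [reassoc_of% h, zero_comp], ?_, h₁, h₀⟩
  refine ShortComplex.shortExact_of_iso (S₁ := ShortComplex.mk f g h)
    (ShortComplex.isoMk (Iso.refl _) (Iso.refl _) e (by simp) (by simp)) hS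

/-- Exactness in terms of generalized elements, for diagram chases in an abstract abelian category.
-/
theorem shortExact_of_refinements {S : ShortComplex C}
    (h₁ : ∀ ⦃A : C⦄ (x : A ⟶ S.X₁), x ≫ S.f = 0 → x = 0)
    (h₂ : ∀ ⦃A : C⦄ (x : A ⟶ S.X₂), x ≫ S.g = 0 →
      ∃ (A' : C) (π : A' ⟶ A) (_ : Epi π) (y : A' ⟶ S.X₁), π ≫ x = y ≫ S.f)
    (h₃ : ∀ ⦃A : C⦄ (x : A ⟶ S.X₃),
      ∃ (A' : C) (π : A' ⟶ A) (_ : Epi π) (y : A' ⟶ S.X₂), π ≫ x = y ≫ S.g) :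
    S.ShortExact where
  exact := S.exact_iff_exact_up_to_refinements.2 fun _ x hx => h₂ x hx
  mono_f := Preadditive.mono_of_cancel_zero _ fun x hx => h₁ x hx
  epi_g := (epi_iff_surjective_up_to_refinements _).2 fun _ x => h₃ x

/-- Since `S.X₁` is projective, `S.f` lifts to `t : S.X₁ ⟶ P₀`; the kernel of `P₀ ⟶ S.X₃` is then
`P₁ ⊞ S.X₁`, embedded by `f` and `t`. -/
theorem IsPresentedBy.quotient {P : ObjectProperty C}
    (hproj : ∀ X, P X → Projective X) (hsum : ∀ X Y, P X → P Y → P (X ⊞ Y))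
    {S : ShortComplex C} (hS : S.ShortExact) (h₁ : P S.X₁) (h₂ : IsPresentedBy P S.X₂) :
    IsPresentedBy P S.X₃ := by
  obtain ⟨P₁, P₀, f, g, h, hT, hP₁, hP₀⟩ := h₂
  have := hproj _ h₁
  have hgepi : Epi g := hT.epi_g
  have hfmono : Mono f := hT.mono_f
  have := hS.epi_g
  have := hS.mono_f
  let t : S.X₁ ⟶ P₀ := Projective.factorThru S.f g
  have ht : t ≫ g = S.f := Projective.factorThru_comp _ _
  refine ⟨P₁ ⊞ S.X₁, P₀, biprod.desc f t, g ≫ S.g, ?_, ?_, hsum _ _ hP₁ h₁, hP₀⟩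
  · ext <;> simp [reassoc_of% h, reassoc_of% ht]
  refine shortExact_of_refinements ?_ ?_ ?_
  · intro A x hx
    dsimp at x hx
    have hx' : (x ≫ biprod.fst) ≫ f + (x ≫ biprod.snd) ≫ t = 0 := by
      have := (congrArg (x ≫ ·) (biprod.desc_eq (f := f) (g := t))).symm.trans hx
      simpa using this
    have h2 : x ≫ biprod.snd = 0 := by
      have := congrArg (· ≫ g) hx'
      simp only [Preadditive.add_comp, Category.assoc, h, ht, comp_zero, zero_add,
        zero_comp] at this
      rw [← cancel_mono S.f, zero_comp, Category.assoc, this]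
    rw [h2, zero_comp, add_zero] at hx'
    have h1 : x ≫ biprod.fst = 0 := by rw [← cancel_mono f, hx', zero_comp]
    ext <;> simp [h1, h2]
  · intro A x hx
    dsimp at x hx ⊢
    obtain ⟨A₁, π₁, hπ₁, y₁, e₁⟩ := hS.exact.exact_up_to_refinements (x ≫ g) (by simpa using hx)
    obtain ⟨A₂, π₂, hπ₂, y₂, e₂⟩ := hT.exact.exact_up_to_refinements (π₁ ≫ x - y₁ ≫ t) (by
      dsimp
      rw [Preadditive.sub_comp, Category.assoc, Category.assoc, ht, e₁, sub_self])
    refine ⟨A₂, π₂ ≫ π₁, epi_comp _ _, biprod.lift y₂ (π₂ ≫ y₁), ?_⟩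
    dsimp at e₂
    rw [biprod.lift_desc, ← e₂]
    simp
  · intro A x
    obtain ⟨A', π, hπ, y, e⟩ := surjective_up_to_refinements_of_epi (g ≫ S.g) x
    exact ⟨A', π, hπ, y, e⟩

/-- The horseshoe construction. The lift `s` of `g'` does not kill `R₁` but sends it into `S.X₁`;
the component `-t` corrects this. -/
theorem IsPresentedBy.extension {P : ObjectProperty C}
    (hproj : ∀ X, P X → Projective X) (hsum : ∀ X Y, P X → P Y → P (X ⊞ Y))
    {S : ShortComplex C} (hS : S.ShortExact) (h₁ : IsPresentedBy P S.X₁)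
    (h₃ : IsPresentedBy P S.X₃) : IsPresentedBy P S.X₂ := by
  obtain ⟨P₁, P₀, f, g, h, hT, hP₁, hP₀⟩ := h₁
  obtain ⟨R₁, R₀, f', g', h', hU, hR₁, hR₀⟩ := h₃
  have := hproj _ hR₁
  have := hproj _ hR₀
  have hgepi : Epi g := hT.epi_g
  have hfmono : Mono f := hT.mono_f
  have hgepi' : Epi g' := hU.epi_g
  have hfmono' : Mono f' := hU.mono_f
  have := hS.epi_g
  have := hS.mono_f
  let s : R₀ ⟶ S.X₂ := Projective.factorThru g' S.g
  have hs : s ≫ S.g = g' := Projective.factorThru_comp _ _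
  let j : R₁ ⟶ S.X₁ := hS.exact.lift (f' ≫ s) (by rw [Category.assoc, hs, h'])
  have hj : j ≫ S.f = f' ≫ s := hS.exact.lift_f _ _
  let t : R₁ ⟶ P₀ := Projective.factorThru j g
  have ht : t ≫ g = j := Projective.factorThru_comp _ _
  refine ⟨P₁ ⊞ R₁, P₀ ⊞ R₀, biprod.desc (f ≫ biprod.inl) (biprod.lift (-t) f'),
    biprod.desc (g ≫ S.f) s, ?_, ?_, hsum _ _ hP₁ hR₁, hsum _ _ hP₀ hR₀⟩
  · ext <;> simp [reassoc_of% h, reassoc_of% ht, hj]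
  refine shortExact_of_refinements ?_ ?_ ?_
  · intro A x hx
    dsimp at x hx
    have hx₂ := congrArg (· ≫ biprod.snd) hx
    have hx₁ := congrArg (· ≫ biprod.fst) hx
    simp only [biprod.desc_eq, Preadditive.comp_add, Preadditive.add_comp, Category.assoc,
      biprod.lift_snd, biprod.lift_fst, biprod.inl_fst, biprod.inl_snd, Category.comp_id,
      comp_zero, zero_comp, zero_add, Preadditive.comp_neg] at hx₁ hx₂
    have h2 : x ≫ biprod.snd = 0 := by
      rw [← cancel_mono f', zero_comp, Category.assoc, hx₂]
    have h1 : x ≫ biprod.fst = 0 := by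
      rw [← cancel_mono f, zero_comp, Category.assoc]
      rwa [reassoc_of% h2, zero_comp, neg_zero, add_zero] at hx₁
    ext <;> simp [h1, h2]
  · intro A x hx
    dsimp at x hx ⊢
    have hx' : x ≫ biprod.fst ≫ g ≫ S.f + x ≫ biprod.snd ≫ s = 0 := by
      have := (congrArg (x ≫ ·) (biprod.desc_eq (f := g ≫ S.f) (g := s))).symm.trans hx
      simpa using this
    obtain ⟨A₁, π₁, hπ₁, y₁, e₁⟩ := hU.exact.exact_up_to_refinements (x ≫ biprod.snd) (by
      have := congrArg (· ≫ S.g) hx'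
      simpa [hs] using this)
    dsimp at e₁
    obtain ⟨A₂, π₂, hπ₂, y₂, e₂⟩ := hT.exact.exact_up_to_refinements
      (π₁ ≫ x ≫ biprod.fst + y₁ ≫ t) (by
        dsimp
        rw [← cancel_mono S.f, zero_comp]
        have := congrArg (π₁ ≫ ·) hx'
        simp only [Preadditive.comp_add, reassoc_of% e₁, comp_zero] at this
        simpa [ht, hj] using this)
    dsimp at e₂
    refine ⟨A₂, π₂ ≫ π₁, epi_comp _ _, biprod.lift y₂ (π₂ ≫ y₁), ?_⟩
    ext
    · simp [← e₂]
    · simp [e₁]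
  · intro A x
    dsimp at x ⊢
    obtain ⟨A₁, π₁, hπ₁, y₁, e₁⟩ := surjective_up_to_refinements_of_epi g' (x ≫ S.g)
    obtain ⟨A₂, π₂, hπ₂, y₂, e₂⟩ := hS.exact.exact_up_to_refinements (π₁ ≫ x - y₁ ≫ s) (by
      rw [Preadditive.sub_comp, Category.assoc, Category.assoc, hs, e₁, sub_self])
    obtain ⟨A₃, π₃, hπ₃, y₃, e₃⟩ := surjective_up_to_refinements_of_epi g y₂
    refine ⟨A₃, π₃ ≫ π₂ ≫ π₁, inferInstance, biprod.lift y₃ (π₃ ≫ π₂ ≫ y₁), ?_⟩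
    rw [biprod.lift_desc, ← reassoc_of% e₃, ← e₂]
    simp

/-- A nonzero retract of an indecomposable object is isomorphic to it. -/
theorem nonempty_iso_of_retract {X Y : C} (hX : Indecomposable X) (hY : ¬ IsZero Y)
    (i : Y ⟶ X) (r : X ⟶ Y) (h : i ≫ r = 𝟙 Y) : Nonempty (X ≅ Y) := by
  have : IsSplitEpi r := ⟨⟨i, h⟩⟩
  have hS : (ShortComplex.mk (kernel.ι r) r (kernel.condition r)).Exact :=
    ShortComplex.exact_of_f_is_kernel _ (kernelIsKernel r)
  have s : (ShortComplex.mk (kernel.ι r) r (kernel.condition r)).Splitting :=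
    ShortComplex.Splitting.ofExactOfSection _ hS i h inferInstance
  rcases hX.2 _ _ s.isoBinaryBiproduct with h0 | h0
  · have : Mono r := Preadditive.mono_of_isZero_kernel _ h0
    have : IsIso r := isIso_of_mono_of_isSplitEpi r
    exact ⟨asIso r⟩
  · exact absurd h0 hY

end Presentation

/-! ### Vertexwise criteria for morphisms and exactness. -/

section Basic

variable {k : Type w} [Field k] {V : Type u} [Quiver.{v} V]

/-- The map by which an arrow acts. -/
abbrev Representation.act (M : Representation k V) {x y : V} (α : x ⟶ y) :
    M.obj ((Paths.of V).obj x) ⟶ M.obj ((Paths.of V).obj y) :=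
  M.map ((Paths.of V).map α)

/-- A morphism of representations, given by a family of maps compatible with the arrows. -/
def mkHom {M N : Representation k V}
    (f : ∀ x : V, M.obj ((Paths.of V).obj x) ⟶ N.obj ((Paths.of V).obj x))
    (hf : ∀ {x y : V} (α : x ⟶ y), M.act α ≫ f y = f x ≫ N.act α) : M ⟶ N where
  app x := f x
  naturality x y p := by
    induction p using Paths.induction with
    | id =>
      rw [M.map_id, N.map_id]
      exact (Category.id_comp _).trans (Category.comp_id _).symm
    | comp p q ih =>
      rw [M.map_comp, N.map_comp]
      exact (Category.assoc _ _ _).trans <| (congrArg (_ ≫ ·) (hf q)).trans <|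
        (Category.assoc _ _ _).symm.trans <| (congrArg (· ≫ _) ih).trans (Category.assoc _ _ _)

theorem shortExact_iff_app {S : ShortComplex (Representation k V)} :
    S.ShortExact ↔ ∀ x : V, (S.map ((evaluation _ _).obj ((Paths.of V).obj x))).ShortExact := by
  refine ⟨fun h x => h.map_of_exact _, fun h => ?_⟩
  refine { exact := ?_, mono_f := ?_, epi_g := ?_ }
  · rw [ShortComplex.exact_iff_isZero_homology, Functor.isZero_iff]
    intro x
    exact ((ShortComplex.exact_iff_isZero_homology _).1 (h x).exact).of_iso
      (S.mapHomologyIso ((evaluation _ _).obj ((Paths.of V).obj x))).symm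
  · rw [NatTrans.mono_iff_mono_app]
    exact fun x => (h x).mono_f
  · rw [NatTrans.epi_iff_epi_app]
    exact fun x => (h x).epi_g

theorem shortExact_of_app {S : ShortComplex (Representation k V)}
    (h₁ : ∀ x : V, Function.Injective (S.f.app ((Paths.of V).obj x)))
    (h₂ : ∀ x : V, ∀ b, S.g.app ((Paths.of V).obj x) b = 0 →
      ∃ a, S.f.app ((Paths.of V).obj x) a = b)
    (h₃ : ∀ x : V, Function.Surjective (S.g.app ((Paths.of V).obj x))) : S.ShortExact := by
  rw [shortExact_iff_app]
  intro x
  refine { exact := ?_, mono_f := ?_, epi_g := ?_ }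
  · rw [ShortComplex.moduleCat_exact_iff]
    exact h₂ x
  · exact (ModuleCat.mono_iff_injective _).2 (h₁ x)
  · exact (ModuleCat.epi_iff_surjective _).2 (h₃ x)

theorem isIso_of_app {M N : Representation k V} (f : M ⟶ N)
    (h : ∀ x : V, Function.Bijective (f.app ((Paths.of V).obj x))) : IsIso f := by
  rw [NatTrans.isIso_iff_isIso_app]
  intro x
  exact (ConcreteCategory.isIso_iff_bijective _).2 (h x)

end Basic

/-! ### Indicator representations -/

section Indicator

variable {k : Type w} [Field k] {V : Type u}

section Space

variable (L : Type*) [AddCommGroup L] [Module k L]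

variable (k) in
/-- The space `L` if `x ∈ S`, and zero otherwise. -/
def indSpace (S : Set V) (x : V) : Submodule k L where
  carrier := {c | x ∉ S → c = 0}
  add_mem' {a b} ha hb h := by rw [ha h, hb h, add_zero]
  zero_mem' _ := rfl
  smul_mem' c a ha h := by rw [ha h, smul_zero]

variable {L}

open scoped Classical in
/-- The map between spaces as above which is the identity where both are nonzero. -/
noncomputable def indMap (S T : Set V) (x y : V) : indSpace k L S x →ₗ[k] indSpace k L T y where
  toFun c := ⟨if y ∈ T then c.1 else 0, fun h => if_neg h⟩
  map_add' a b := by ext1; by_cases h : y ∈ T <;> simp [h]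
  map_smul' a b := by ext1; by_cases h : y ∈ T <;> simp [h]

theorem indMap_of_mem {S T : Set V} {x y : V} (h : y ∈ T) (c : indSpace k L S x) :
    (indMap S T x y c).1 = c.1 := if_pos h

theorem indMap_of_notMem {S T : Set V} {x y : V} (h : y ∉ T) (c : indSpace k L S x) :
    (indMap S T x y c).1 = 0 := if_neg h

theorem indSpace_eq_zero {S : Set V} {x : V} (h : x ∉ S) (c : indSpace k L S x) : c = 0 :=
  Subtype.ext (c.2 h)

theorem nontrivial_indSpace [Nontrivial L] {S : Set V} {x : V} (h : x ∈ S) :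
    Nontrivial (indSpace k L S x) := by
  obtain ⟨c, hc⟩ := exists_ne (0 : L)
  exact ⟨⟨⟨c, fun h' => absurd h h'⟩, 0, fun h => hc (congrArg Subtype.val h)⟩⟩

/-- Only `x ∈ S`, `y ∈ T` matters: there one composite is the identity or zero according to `y ∈ S`,
the other according to `x ∈ T`. -/
theorem indMap_comm {S T : Set V} {x y : V} (h : x ∈ S → y ∈ T → (x ∈ T ↔ y ∈ S)) :
    (indMap S T y y).comp (indMap (k := k) (L := L) S S x y) =
      (indMap T T x y).comp (indMap S T x x) := by
  ext c
  change (indMap S T y y (indMap S S x y c)).1 = (indMap T T x y (indMap S T x x c)).1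
  by_cases hx : x ∈ S
  · by_cases hy : y ∈ T
    · rw [indMap_of_mem hy, indMap_of_mem hy]
      by_cases hxT : x ∈ T
      · rw [indMap_of_mem hxT, indMap_of_mem ((h hx hy).1 hxT)]
      · rw [indMap_of_notMem hxT, indMap_of_notMem (fun hyS => hxT ((h hx hy).2 hyS))]
    · rw [indMap_of_notMem hy, indMap_of_notMem hy]
  · rw [indSpace_eq_zero hx c]; simp

theorem indMap_comp_of_disjoint {S T U : Set V} (h : Disjoint S T) (x : V) :
    (indMap (k := k) (L := L) U T x x).comp (indMap S U x x) = 0 := by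
  ext c
  change (indMap U T x x (indMap S U x x c)).1 = 0
  by_cases hx : x ∈ T
  · rw [indSpace_eq_zero (fun h' => Set.disjoint_left.1 h h' hx) c]; simp
  · exact indMap_of_notMem hx _

theorem indMap_injective {S T : Set V} (h : S ⊆ T) (x : V) :
    Function.Injective (indMap (k := k) (L := L) S T x x) := by
  intro a b hab
  have hab := congrArg Subtype.val hab
  by_cases hx : x ∈ S
  · rw [indMap_of_mem (h hx), indMap_of_mem (h hx)] at hab
    exact Subtype.ext hab
  · exact (indSpace_eq_zero hx a).trans (indSpace_eq_zero hx b).symm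

theorem indMap_surjective {S T : Set V} (h : T ⊆ S) (x : V) :
    Function.Surjective (indMap (k := k) (L := L) S T x x) := by
  intro c
  refine ⟨⟨c.1, fun h' => c.2 fun hx => h' (h hx)⟩, Subtype.ext ?_⟩
  by_cases hx : x ∈ T
  · exact indMap_of_mem hx _
  · exact (indMap_of_notMem hx _).trans (c.2 hx).symm

theorem indMap_exact {S T : Set V} (x : V) (b : indSpace k L (S ∪ T) x)
    (hb : indMap (S ∪ T) T x x b = 0) : ∃ a : indSpace k L S x, indMap S (S ∪ T) x x a = b := by
  have hb : (indMap (S ∪ T) T x x b).1 = 0 := congrArg Subtype.val hb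
  by_cases hx : x ∈ S
  · exact ⟨⟨b.1, fun h => absurd hx h⟩, Subtype.ext (indMap_of_mem (Or.inl hx) _)⟩
  · refine ⟨0, (map_zero _).trans (Subtype.ext ?_)⟩
    by_cases hxT : x ∈ T
    · rw [indMap_of_mem hxT] at hb
      exact hb.symm
    · exact (b.2 (by simp [hx, hxT])).symm

end Space

variable [Quiver.{v} V]

variable (k)

/-- The representation which is `k` on `S` and zero elsewhere, all arrows inside `S` acting as the
identity. -/
noncomputable def ind (S : Set V) : Representation k V :=
  Paths.lift
    { obj := fun x => ModuleCat.of k (indSpace k (ULift.{max u v} k) S x)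
      map := fun {x y} _ => ModuleCat.ofHom (indMap S S x y) }

variable {k}

theorem ind_act (S : Set V) {x y : V} (α : x ⟶ y) :
    (ind k S).act α = ModuleCat.ofHom (indMap S S x y) :=
  Paths.lift_toPath _ α

variable (k) in
theorem isZero_ind_empty : IsZero (ind k (∅ : Set V)) := by
  rw [Functor.isZero_iff]
  intro x
  rw [ModuleCat.isZero_iff_subsingleton]
  exact ⟨fun (a b : indSpace k (ULift.{max u v} k) ∅ x) =>
    (indSpace_eq_zero (Set.notMem_empty _) a).trans
    (indSpace_eq_zero (Set.notMem_empty _) b).symm⟩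

/-- The natural morphism between indicator representations, when it exists. -/
noncomputable def indHom {S T : Set V}
    (h : ∀ {x y : V}, (x ⟶ y) → x ∈ S → y ∈ T → (x ∈ T ↔ y ∈ S)) : ind k S ⟶ ind k T :=
  mkHom (fun x => ModuleCat.ofHom (indMap S T x x)) (by
    intro x y α
    rw [ind_act, ind_act]
    exact congrArg ModuleCat.ofHom (indMap_comm (h α)))

variable (k) in
/-- The indicator representation of a disjoint union, when no arrow goes from the first set to the
second, is an extension. -/
theorem exists_shortExact_ind {S T U : Set V} (hU : U = S ∪ T) (hd : Disjoint S T)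
    (h : ∀ {x y : V}, (x ⟶ y) → x ∈ S → y ∈ T → False) :
    ∃ X : ShortComplex (Representation k V), X.ShortExact ∧ X.X₁ = ind k S ∧ X.X₂ = ind k U ∧
      X.X₃ = ind k T := by
  subst hU
  let f : ind k S ⟶ ind k (S ∪ T) := indHom fun {x y} α hx hy =>
    ⟨fun _ => hy.resolve_right fun hy => h α hx hy, fun _ => Or.inl hx⟩
  let g : ind k (S ∪ T) ⟶ ind k T := indHom fun {x y} α hx hy =>
    ⟨fun _ => Or.inr hy, fun _ => hx.resolve_left fun hx => h α hx hy⟩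
  refine ⟨ShortComplex.mk f g ?_, shortExact_of_app ?_ ?_ ?_, rfl, rfl, rfl⟩
  · ext1
    funext x
    exact congrArg ModuleCat.ofHom (indMap_comp_of_disjoint hd x)
  · exact fun x => indMap_injective Set.subset_union_left x
  · exact fun x => indMap_exact x
  · exact fun x => indMap_surjective Set.subset_union_right x

theorem ind_isLocallyFiniteDimensional (S : Set V) :
    IsLocallyFiniteDimensional (ind k S) := by
  intro x
  have : FiniteDimensional k (ULift.{max u v} k) :=
    Module.Finite.equiv (ULift.moduleEquiv (R := k) (M := k)).symm
  exact (inferInstance : FiniteDimensional k (indSpace k (ULift.{max u v} k) S x))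

end Indicator

/-! ### Projective representations -/

section Projective

variable {k : Type w} [Field k] {V : Type u} [Quiver.{v} V]

open scoped TensorProduct

/-- The element `p ⊗ u` of `(P_a ⊗ U)(x)`. -/
noncomputable def projTensorMk {a : V} (U : ModuleCat.{max u v w} k) {x : Paths V}
    (p : (Paths.of V).obj a ⟶ x) (c : U) : (projTensor a U).obj x :=
  (Finsupp.single p (1 : k) ⊗ₜ[k] c :
    TensorProduct k (((Paths.of V).obj a ⟶ x) →₀ k) U)

theorem projTensor_map_mk {a : V} (U : ModuleCat.{max u v w} k) {x y : Paths V}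
    (p : (Paths.of V).obj a ⟶ x) (q : x ⟶ y) (c : U) :
    (projTensor a U).map q (projTensorMk U p c) = projTensorMk U (p ≫ q) c := by
  refine (LinearMap.rTensor_tmul U (Finsupp.lmapDomain k k fun r => r ≫ q) c
    (Finsupp.single p (1 : k))).trans ?_
  exact congrArg (fun t => (t ⊗ₜ[k] c : TensorProduct k (((Paths.of V).obj a ⟶ y) →₀ k) U))
    Finsupp.mapDomain_single

/-- Coefficients can be moved into `U`, so the elements `p ⊗ c` with `p` a path already span
additively. -/
theorem projTensor_induction {a : V} (U : ModuleCat.{max u v w} k) {x : Paths V}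
    {motive : (projTensor a U).obj x → Prop} (z : (projTensor a U).obj x)
    (zero : motive 0) (add : ∀ y z, motive y → motive z → motive (y + z))
    (mk : ∀ p c, motive (projTensorMk U p c)) : motive z := by
  have aux : ∀ t t' : TensorProduct k (((Paths.of V).obj a ⟶ x) →₀ k) U, t = t' → motive t' →
      motive t := fun t t' h h' => h ▸ h'
  refine TensorProduct.induction_on (motive := motive) z zero (fun f c => ?_) add
  induction f using Finsupp.induction_linear with
  | zero => exact aux _ _ (TensorProduct.zero_tmul _ c) zero
  | add f g hf hg => exact aux _ _ (TensorProduct.add_tmul f g c) (add _ _ hf hg)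
  | single p r =>
    refine aux _ (Finsupp.single p (1 : k) ⊗ₜ[k] (r • c)) ?_ (mk p (r • c))
    rw [TensorProduct.tmul_smul, TensorProduct.smul_tmul', Finsupp.smul_single, smul_eq_mul,
      mul_one]

theorem projTensor_hom_ext {a : V} {U : ModuleCat.{max u v w} k} {M : Representation k V}
    {f g : projTensor a U ⟶ M}
    (h : ∀ c : U, f.app _ (projTensorMk U (𝟙 _) c) = g.app _ (projTensorMk U (𝟙 _) c)) :
    f = g := by
  ext x z
  refine projTensor_induction U (motive := fun z => f.app x z = g.app x z) z ?_ ?_ ?_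
  · exact (map_zero _).trans (map_zero _).symm
  · intro y z hy hz
    exact (map_add _ _ _).trans ((congrArg₂ _ hy hz).trans (map_add _ _ _).symm)
  · intro p c
    have := projTensor_map_mk U (𝟙 _) p c
    rw [Category.id_comp] at this
    rw [← this, NatTrans.naturality_apply, NatTrans.naturality_apply, h]

/-- The morphism `P_a ⊗ U ⟶ M` given by a linear map `U ⟶ M(a)`. -/
noncomputable def projTensorDesc {a : V} {U : ModuleCat.{max u v w} k} {M : Representation k V}
    (f : U →ₗ[k] M.obj ((Paths.of V).obj a)) : projTensor a U ⟶ M where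
  app x := ModuleCat.ofHom (TensorProduct.lift (Finsupp.linearCombination k
    fun p : ((Paths.of V).obj a ⟶ x) => (M.map p).hom.comp f))
  naturality x y q := by
    ext z
    generalize hl : (projTensor a U).map q ≫ _ = l
    generalize hr : _ ≫ M.map q = r
    refine projTensor_induction U (motive := fun z => l.hom z = r.hom z) z ?_ ?_ ?_
    · exact (map_zero _).trans (map_zero _).symm
    · intro y z hy hz
      exact (map_add _ _ _).trans ((congrArg₂ _ hy hz).trans (map_add _ _ _).symm)
    · intro p c
      subst hl hr
      refine (congrArg (TensorProduct.lift (Finsupp.linearCombination k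
        fun p : ((Paths.of V).obj a ⟶ y) => (M.map p).hom.comp f))
        (projTensor_map_mk U p q c)).trans ?_
      refine (TensorProduct.lift.tmul _ _).trans ?_
      refine Eq.trans ?_ (congrArg (M.map q) (TensorProduct.lift.tmul _ _)).symm
      simp only [Finsupp.linearCombination_single, one_smul, LinearMap.comp_apply, M.map_comp]
      rfl

theorem projTensorDesc_mk {a : V} {U : ModuleCat.{max u v w} k} {M : Representation k V}
    (f : U →ₗ[k] M.obj ((Paths.of V).obj a)) {x : Paths V} (p : (Paths.of V).obj a ⟶ x) (c : U) :
    (projTensorDesc f).app x (projTensorMk U p c) = M.map p (f c) := by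
  refine (TensorProduct.lift.tmul _ _).trans ?_
  simp only [Finsupp.linearCombination_single, one_smul, LinearMap.comp_apply]

/-- A morphism out of `P_a ⊗ U` amounts to a linear map out of `U`, by evaluation at the trivial
path; it lifts because the surjection `e` at `a` has a linear section. -/
instance (a : V) (U : ModuleCat.{max u v w} k) : Projective (projTensor a U) where
  factors {N M} f e he := by
    have he : Function.Surjective (e.app ((Paths.of V).obj a)) :=
      (ModuleCat.epi_iff_surjective _).1 ((NatTrans.epi_iff_epi_app e).1 he _)
    obtain ⟨s, hs⟩ := LinearMap.exists_rightInverse_of_surjective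
      (e.app ((Paths.of V).obj a)).hom (LinearMap.range_eq_top.2 he)
    let g : U →ₗ[k] N.obj ((Paths.of V).obj a) :=
      { toFun := fun c => s (f.app _ (projTensorMk U (𝟙 _) c))
        map_add' := fun b c => by
          rw [← map_add, ← map_add]
          exact congrArg (fun z => s (f.app _ z)) (TensorProduct.tmul_add _ b c)
        map_smul' := fun r c => by
          rw [RingHom.id_apply, ← map_smul, ← map_smul]
          exact congrArg (fun z => s (f.app _ z)) (TensorProduct.tmul_smul r _ c) }
    refine ⟨projTensorDesc g, projTensor_hom_ext fun c => ?_⟩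
    refine (congrArg (e.app _) (projTensorDesc_mk g _ c)).trans ?_
    rw [N.map_id]
    exact LinearMap.congr_fun hs _

theorem IsProj.of_finite {ι : Type} [Finite ι] (a : ι → V) (U : ι → ModuleCat.{max u v w} k) :
    IsProj (sigmaObj fun i => projTensor (a i) (U i)) := by
  obtain ⟨n, ⟨e⟩⟩ := Finite.exists_equiv_fin ι
  refine ⟨n, a ∘ e.symm, U ∘ e.symm, ⟨Sigma.whiskerEquiv e fun i => ?_⟩⟩
  exact eqToIso (by simp)

theorem IsProj.of_iso {P R : Representation k V} (e : P ≅ R) (h : IsProj P) : IsProj R := by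
  obtain ⟨n, a, U, ⟨e'⟩⟩ := h
  exact ⟨n, a, U, ⟨e.symm ≪≫ e'⟩⟩

theorem IsProj.biprod {P R : Representation k V} (hP : IsProj P) (hR : IsProj R) :
    IsProj (P ⊞ R) := by
  obtain ⟨m, a, U, ⟨e⟩⟩ := hP
  obtain ⟨n, b, W, ⟨e'⟩⟩ := hR
  let X : Fin m ⊕ Fin n → Representation k V := fun i =>
    projTensor (Sum.elim a b i) (Sum.elim U W i)
  have hb := MonoCoprod.isColimitBinaryCofanSum (X := X) (Cofan.mk _ (Sigma.ι X))
    (Cofan.mk _ (Sigma.ι fun i => projTensor (a i) (U i)))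
    (Cofan.mk _ (Sigma.ι fun i => projTensor (b i) (W i))) (coproductIsCoproduct _)
    (coproductIsCoproduct _) (coproductIsCoproduct _)
  refine (IsProj.of_finite (Sum.elim a b) (Sum.elim U W)).of_iso ?_
  exact hb.coconePointUniqueUpToIso (BinaryBiproduct.isColimit _ _) ≪≫
    (biprod.mapIso e e').symm

theorem isProj_projTensor (a : V) (U : ModuleCat.{max u v w} k) : IsProj (projTensor a U) :=
  (IsProj.of_finite (ι := Unit) (fun _ => a) (fun _ => U)).of_iso
    ((coproductUniqueIso (β := Unit) _))

theorem IsProj.of_isZero {P : Representation k V} (h : IsZero P) : IsProj P := by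
  refine (IsProj.of_finite (ι := Empty) (fun i => i.elim) (fun i => i.elim)).of_iso ?_
  exact IsZero.iso (by
    rw [IsZero.iff_id_eq_zero]
    exact Sigma.hom_ext _ _ fun i => i.elim) h

theorem IsProj.projective {P : Representation k V} (h : IsProj P) : Projective P := by
  obtain ⟨n, a, U, ⟨e⟩⟩ := h
  have : ∀ i, Projective (projTensor (a i) (U i)) := fun i => inferInstance
  have : Projective (∐ fun i => projTensor (a i) (U i)) :=
    { factors := fun f e _ => ⟨Sigma.desc fun b =>
          Projective.factorThru (Sigma.ι (fun i => projTensor (a i) (U i)) b ≫ f) e,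
        Sigma.hom_ext _ _ fun b => by simp⟩ }
  exact Projective.of_iso e.symm this

/-! ### Finitely presented representations -/

theorem IsLocallyFiniteDimensional.of_shortExact {S : ShortComplex (Representation k V)}
    (hS : S.ShortExact) (h₁ : IsLocallyFiniteDimensional S.X₁)
    (h₃ : IsLocallyFiniteDimensional S.X₃) : IsLocallyFiniteDimensional S.X₂ := by
  intro x
  have hx := shortExact_iff_app.1 hS x
  have := h₁ x
  have := h₃ x
  exact Module.Finite.of_exact (f := (S.f.app ((Paths.of V).obj x)).hom)
    (g := (S.g.app ((Paths.of V).obj x)).hom)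
    ((ShortComplex.ShortExact.moduleCat_exact_iff_function_exact _).1 hx.exact)
    ((ModuleCat.epi_iff_surjective _).1 hx.epi_g)

variable (k V) in
/-- The locally finite dimensional objects of `proj(Q)`. -/
def projLF : ObjectProperty (Representation k V) :=
  fun P => IsProj P ∧ IsLocallyFiniteDimensional P

theorem isFinitelyPresented_iff {M : Representation k V} :
    IsFinitelyPresented M ↔ IsPresentedBy (projLF k V) M := by
  constructor
  · rintro ⟨P₁, P₀, f, g, h, hS, h₁, h₂, h₃, h₄⟩
    exact ⟨P₁, P₀, f, g, h, hS, ⟨h₁, h₂⟩, ⟨h₃, h₄⟩⟩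
  · rintro ⟨P₁, P₀, f, g, h, hS, ⟨h₁, h₂⟩, ⟨h₃, h₄⟩⟩
    exact ⟨P₁, P₀, f, g, h, hS, h₁, h₂, h₃, h₄⟩

theorem projLF_biprod {P R : Representation k V} (hP : projLF k V P) (hR : projLF k V R) :
    projLF k V (P ⊞ R) :=
  ⟨hP.1.biprod hR.1, IsLocallyFiniteDimensional.of_shortExact
    (ShortComplex.Splitting.ofHasBinaryBiproduct P R).shortExact hP.2 hR.2⟩

theorem IsFinitelyPresented.of_iso {M N : Representation k V} (e : M ≅ N)
    (h : IsFinitelyPresented M) : IsFinitelyPresented N :=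
  isFinitelyPresented_iff.2 ((isFinitelyPresented_iff.1 h).of_iso e)

theorem IsFinitelyPresented.quotient {S : ShortComplex (Representation k V)} (hS : S.ShortExact)
    (h₁ : projLF k V S.X₁) (h₂ : IsFinitelyPresented S.X₂) : IsFinitelyPresented S.X₃ :=
  isFinitelyPresented_iff.2 (IsPresentedBy.quotient (fun _ h => h.1.projective)
    (fun _ _ => projLF_biprod) hS h₁ (isFinitelyPresented_iff.1 h₂))

theorem IsFinitelyPresented.extension {S : ShortComplex (Representation k V)} (hS : S.ShortExact)
    (h₁ : IsFinitelyPresented S.X₁) (h₃ : IsFinitelyPresented S.X₃) : IsFinitelyPresented S.X₂ :=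
  isFinitelyPresented_iff.2 (IsPresentedBy.extension (fun _ h => h.1.projective)
    (fun _ _ => projLF_biprod) hS (isFinitelyPresented_iff.1 h₁) (isFinitelyPresented_iff.1 h₃))

theorem projLF_ind_empty : projLF k V (ind k (∅ : Set V)) :=
  ⟨IsProj.of_isZero (isZero_ind_empty k), ind_isLocallyFiniteDimensional _⟩

theorem IsFinitelyPresented.of_projLF {P : Representation k V} (h : projLF k V P) :
    IsFinitelyPresented P := by
  refine isFinitelyPresented_iff.2 ⟨_, P, 0, 𝟙 P, zero_comp, ?_, projLF_ind_empty, h⟩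
  refine { exact := ?_, mono_f := ?_, epi_g := inferInstance }
  · rw [ShortComplex.exact_iff_mono _ rfl]
    exact inferInstanceAs (Mono (𝟙 P))
  · exact Preadditive.mono_of_cancel_zero _ fun x _ => (isZero_ind_empty k).eq_of_tgt _ _

end Projective

/-! ### Quivers whose vertices lie on a line -/

/-- The vertices of the quiver are embedded as an interval of `ℤ`, there is exactly one arrow
between neighbours and no other arrow. -/
structure LinePos {V : Type u} [Quiver.{v} V] (pos : V → ℤ) : Prop where
  inj : Function.Injective pos
  exists_between : ∀ {x y : V} {n : ℤ}, pos x ≤ n → n ≤ pos y → ∃ z, pos z = n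
  step : ∀ {x y : V}, (x ⟶ y) → pos y = pos x + 1 ∨ pos x = pos y + 1
  total : ∀ {x y : V}, pos y = pos x + 1 → Nonempty (x ⟶ y) ∨ Nonempty (y ⟶ x)
  antisymm : ∀ {x y : V}, (x ⟶ y) → (y ⟶ x) → False
  subsingleton : ∀ x y : V, Subsingleton (x ⟶ y)

section Line

variable {V : Type u} [Quiver.{v} V]

theorem linePos_of_hasUnderlyingGraph {I : Type} (G : SimpleGraph I) (f : I → ℤ)
    (hf : Function.Injective f) (hG : ∀ i j, G.Adj i j ↔ f j = f i + 1 ∨ f i = f j + 1)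
    (hI : ∀ (i j : I) (n : ℤ), f i ≤ n → n ≤ f j → ∃ l, f l = n)
    (h : HasUnderlyingGraph V G) : ∃ pos : V → ℤ, LinePos pos := by
  obtain ⟨e, he⟩ := h
  have adj : ∀ {x y : V}, (x ⟶ y) → G.Adj (e.symm x) (e.symm y) := by
    intro x y α
    by_contra hc
    have := (he _ _).2 hc
    rw [e.apply_symm_apply, e.apply_symm_apply] at this
    exact this.elim α
  have uniq : ∀ {x y : V}, G.Adj (e.symm x) (e.symm y) →
      Subsingleton ((x ⟶ y) ⊕ (y ⟶ x)) ∧ Nonempty ((x ⟶ y) ⊕ (y ⟶ x)) := by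
    intro x y hxy
    have := (he _ _).1 hxy
    rwa [Nat.card_eq_one_iff_unique, e.apply_symm_apply, e.apply_symm_apply] at this
  refine ⟨fun x => f (e.symm x), ⟨hf.comp e.symm.injective, ?_, ?_, ?_, ?_, ?_⟩⟩
  · intro x y n hx hy
    obtain ⟨l, hl⟩ := hI _ _ n hx hy
    exact ⟨e l, by rwa [e.symm_apply_apply]⟩
  · exact fun α => (hG _ _).1 (adj α)
  · intro x y h
    obtain ⟨-, ⟨α | α⟩⟩ := uniq ((hG _ _).2 (Or.inl h))
    exacts [Or.inl ⟨α⟩, Or.inr ⟨α⟩]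
  · intro x y α β
    have := (uniq (adj α)).1
    exact Sum.inl_ne_inr (Subsingleton.elim (Sum.inl α : (x ⟶ y) ⊕ (y ⟶ x)) (Sum.inr β))
  · intro x y
    refine ⟨fun α β => ?_⟩
    have := (uniq (adj α)).1
    exact Sum.inl_injective (Subsingleton.elim (Sum.inl α : (x ⟶ y) ⊕ (y ⟶ x)) (Sum.inl β))

theorem exists_linePos (hQ : IsTypeAInfInf V ∨ IsTypeAInf V) : ∃ pos : V → ℤ, LinePos pos := by
  rcases hQ with hQ | hQ
  · refine linePos_of_hasUnderlyingGraph _ id Function.injective_id ?_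
      (fun _ _ n _ _ => ⟨n, rfl⟩) hQ
    intro i j
    simp only [SimpleGraph.hasse_adj, Order.covBy_iff_add_one_eq, id]
    omega
  · refine linePos_of_hasUnderlyingGraph _ (fun n : ℕ => (n : ℤ)) Nat.cast_injective ?_
      (fun i _ n hi _ => ⟨n.toNat, by omega⟩) hQ
    intro i j
    simp only [SimpleGraph.hasse_adj, Order.covBy_iff_add_one_eq]
    omega

namespace LinePos

variable {pos : V → ℤ} (hV : LinePos pos)

include hV

/-- Reflecting the line leaves the quiver unchanged, so each statement about the right end gives one
about the left end. -/
theorem neg : LinePos fun x => - pos x where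
  inj x y h := hV.inj (neg_injective h)
  exists_between {x y n} hx hy := by
    obtain ⟨z, hz⟩ := hV.exists_between (x := y) (y := x) (n := -n) (by omega) (by omega)
    exact ⟨z, by omega⟩
  step α := by have := hV.step α; omega
  total {x y} h := (hV.total (x := y) (y := x) (by omega)).symm
  antisymm := hV.antisymm
  subsingleton := hV.subsingleton

/-- A discrete intermediate value argument: arrows move by one position, so a path from the left of
an edge to its right must use that edge. -/
theorem arrow_of_path_right {a b : V} (p : Quiver.Path a b) {x y : V} (hxy : pos y = pos x + 1)
    (hx : pos a ≤ pos x) (hy : pos y ≤ pos b) : Nonempty (x ⟶ y) := by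
  induction p with
  | nil => omega
  | @cons b c p α ih =>
    by_cases h : pos y ≤ pos b
    · exact ih h
    · have h₁ := hV.step α
      have h₂ : x = b := hV.inj (by omega)
      have h₃ : y = c := hV.inj (by omega)
      subst h₂ h₃
      exact ⟨α⟩

theorem arrow_of_path_left {a b : V} (p : Quiver.Path a b) {x y : V} (hxy : pos x = pos y + 1)
    (hx : pos x ≤ pos a) (hy : pos b ≤ pos y) : Nonempty (x ⟶ y) :=
  hV.neg.arrow_of_path_right p (by omega) (by omega) (by omega)

/-- Paths never turn back: if `α` pointed towards the side of `a`, then `p` would have crossed the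
same edge in the opposite direction. Thus paths move monotonically away from `a`. -/
theorem path_arrow {a b c : V} (p : Quiver.Path a c) (α : c ⟶ b) :
    pos b = pos c + 1 ∧ pos a ≤ pos c ∨ pos c = pos b + 1 ∧ pos c ≤ pos a := by
  rcases hV.step α with h | h
  · by_cases h' : pos a ≤ pos c
    · exact Or.inl ⟨h, h'⟩
    · obtain ⟨β⟩ := hV.arrow_of_path_left p h (by omega) le_rfl
      exact (hV.antisymm α β).elim
  · by_cases h' : pos c ≤ pos a
    · exact Or.inr ⟨h, h'⟩
    · obtain ⟨β⟩ := hV.arrow_of_path_right p h (by omega) le_rfl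
      exact (hV.antisymm α β).elim

theorem subsingleton_path (a b : V) : Subsingleton (Quiver.Path a b) := by
  refine ⟨fun p q => ?_⟩
  induction p with
  | nil =>
    cases q with
    | nil => rfl
    | cons q β => have := hV.path_arrow q β; omega
  | @cons c b p α ih =>
    cases q with
    | nil => have := hV.path_arrow p α; omega
    | @cons c' _ q β =>
      have h₁ := hV.path_arrow p α
      have h₂ := hV.path_arrow q β
      have h₃ := hV.inj (show pos c' = pos c by omega)
      subst h₃
      rw [ih q, (hV.subsingleton _ _).elim α β]

end LinePos

/-- The vertices that can be reached from `a`. -/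
def reach (a : V) : Set V := {x | Nonempty (Quiver.Path a x)}

theorem self_mem_reach (a : V) : a ∈ reach a := ⟨Quiver.Path.nil⟩

theorem reach_of_arrow {a x y : V} (hx : x ∈ reach a) (α : x ⟶ y) : y ∈ reach a :=
  hx.map fun p => p.cons α

namespace LinePos

variable {pos : V → ℤ} (hV : LinePos pos)

include hV

/-- A path from `b` to its left starts with the arrow to the left neighbour `b'` and never returns.
So the left part of `P_b` is zero or `P_b'`, hence again projective. -/
theorem reach_below (b : V) : {x ∈ reach b | pos x < pos b} = ∅ ∨
    ∃ b', {x ∈ reach b | pos x < pos b} = reach b' := by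
  have key : ∀ {x : V} (p : Quiver.Path b x), pos x < pos b →
      ∃ b', pos b' = pos b - 1 ∧ Nonempty (b ⟶ b') ∧ x ∈ reach b' := by
    intro x p hx
    induction p with
    | nil => omega
    | @cons c x p α ih =>
      have h := hV.path_arrow p α
      by_cases hc : pos c < pos b
      · obtain ⟨b', h₁, h₂, h₃⟩ := ih hc
        exact ⟨b', h₁, h₂, reach_of_arrow h₃ α⟩
      · have h' : c = b := hV.inj (by omega)
        subst h'
        exact ⟨x, by omega, ⟨α⟩, self_mem_reach x⟩
  by_cases hne : ({x ∈ reach b | pos x < pos b} : Set V) = ∅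
  · exact Or.inl hne
  obtain ⟨x, ⟨p⟩, hx⟩ := Set.nonempty_iff_ne_empty.2 hne
  obtain ⟨b', h₁, ⟨α⟩, -⟩ := key p hx
  refine Or.inr ⟨b', Set.ext fun y => ⟨?_, ?_⟩⟩
  · rintro ⟨⟨q⟩, hy⟩
    obtain ⟨b'', h₂, -, h₃⟩ := key q hy
    rwa [hV.inj (show pos b' = pos b'' by omega)]
  · rintro ⟨q⟩
    refine ⟨⟨α.toPath.comp q⟩, ?_⟩
    by_contra hy
    obtain ⟨β⟩ := hV.arrow_of_path_right q (x := b') (y := b) (by omega) le_rfl (by omega)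
    exact hV.antisymm α β

end LinePos

variable {k : Type w} [Field k]

theorem ind_map_val {S : Set V} {a : V} (h : reach a ⊆ S)
    (c : indSpace k (ULift.{max u v} k) S a) {x : Paths V} (p : (Paths.of V).obj a ⟶ x) :
    ((ind k S).map p c : indSpace k (ULift.{max u v} k) S x).1 = c.1 := by
  induction p using Paths.induction_fixed_source with
  | id => rw [(ind k S).map_id]; rfl
  | @comp y z p q ih =>
    rw [(ind k S).map_comp]
    have hz : z ∈ S := h ⟨Quiver.Path.cons p q⟩
    refine Eq.trans ?_ ih
    change (((ind k S).act q) _ : indSpace k (ULift.{max u v} k) S z).1 = _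
    rw [ind_act]
    exact indMap_of_mem hz _

theorem isProj_ind_reach {pos : V → ℤ} (hV : LinePos pos) (a : V) : IsProj (ind k (reach a)) := by
  -- This one-dimensional space is the value of `ind k (reach a)` at `a` itself, so that the
  -- comparison map is induced by the identity.
  let U : ModuleCat.{max u v w} k := ModuleCat.of k (indSpace k (ULift.{max u v} k) (reach a) a)
  let f : projTensor a U ⟶ ind k (reach a) := projTensorDesc LinearMap.id
  have hf : ∀ {x : V} (p : (Paths.of V).obj a ⟶ (Paths.of V).obj x) (c : U),
      (f.app ((Paths.of V).obj x) (projTensorMk U p c) :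
        indSpace k (ULift.{max u v} k) (reach a) x).1 = c.1 := by
    intro x p c
    exact (congrArg (fun z : indSpace k (ULift.{max u v} k) (reach a) x => z.1)
      (projTensorDesc_mk _ p c)).trans (ind_map_val subset_rfl c p)
  have : IsIso f := by
    refine isIso_of_app f fun x => ⟨?_, ?_⟩
    -- As there is only one path from `a` to `x`, sums of elements `p ⊗ c` are again of this form.
    · have hz : ∀ z : (projTensor a U).obj ((Paths.of V).obj x), z = 0 ∨
          ∃ p c, z = projTensorMk U (x := (Paths.of V).obj x) p c := by
        intro z
        refine projTensor_induction U (motive := fun z => z = 0 ∨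
          ∃ p c, z = projTensorMk U (x := (Paths.of V).obj x) p c) z (Or.inl rfl) ?_ ?_
        · rintro y z (rfl | ⟨p, c, rfl⟩) hz
          · rwa [zero_add]
          rcases hz with rfl | ⟨q, d, rfl⟩
          · exact Or.inr ⟨p, c, add_zero _⟩
          · refine Or.inr ⟨p, c + d, ?_⟩
            rw [show q = p from (hV.subsingleton_path a x).elim q p]
            exact (TensorProduct.tmul_add _ c d).symm
        · exact fun p c => Or.inr ⟨p, c, rfl⟩
      refine (injective_iff_map_eq_zero _).2 fun z hz' => ?_
      rcases hz z with rfl | ⟨p, c, rfl⟩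
      · rfl
      · have h0 : c = 0 := by
          refine Subtype.ext ((hf p c).symm.trans ?_)
          exact congrArg (fun z : indSpace k (ULift.{max u v} k) (reach a) x => z.1) hz'
        rw [h0]
        exact TensorProduct.tmul_zero _ _
    · intro (c : indSpace k (ULift.{max u v} k) (reach a) x)
      by_cases hx : x ∈ reach a
      · obtain ⟨p⟩ := hx
        exact ⟨projTensorMk U (x := (Paths.of V).obj x) p
          ⟨c.1, fun h => absurd (self_mem_reach a) h⟩, Subtype.ext (hf (x := x) p _)⟩
      · exact ⟨0, (map_zero _).trans (indSpace_eq_zero hx c).symm⟩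
  exact (isProj_projTensor a U).of_iso (asIso f)

theorem projLF_ind_reach {pos : V → ℤ} (hV : LinePos pos) (a : V) :
    projLF k V (ind k (reach a)) :=
  ⟨isProj_ind_reach hV a, ind_isLocallyFiniteDimensional _⟩

theorem projLF_ind_reach_below {pos : V → ℤ} (hV : LinePos pos) (b : V) :
    projLF k V (ind k {x ∈ reach b | pos x < pos b}) := by
  rcases hV.reach_below b with h | ⟨b', h⟩
  · rw [h]; exact projLF_ind_empty
  · rw [h]; exact projLF_ind_reach hV b'

theorem projLF_ind_reach_above {pos : V → ℤ} (hV : LinePos pos) (b : V) :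
    projLF k V (ind k {x ∈ reach b | pos b < pos x}) := by
  simpa only [neg_lt_neg_iff] using projLF_ind_reach_below (k := k) hV.neg b

theorem IsFinitelyPresented.ind_quotient {S T U : Set V} (hU : U = S ∪ T) (hd : Disjoint S T)
    (h : ∀ {x y : V}, (x ⟶ y) → x ∈ S → y ∈ T → False) (hS : projLF k V (ind k S))
    (hUp : IsFinitelyPresented (ind k U)) : IsFinitelyPresented (ind k T) := by
  obtain ⟨X, hX, h₁, h₂, h₃⟩ := exists_shortExact_ind k hU hd h
  rw [← h₃]
  exact IsFinitelyPresented.quotient hX (h₁ ▸ hS) (h₂ ▸ hUp)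

theorem IsFinitelyPresented.ind_extension {S T U : Set V} (hU : U = S ∪ T) (hd : Disjoint S T)
    (h : ∀ {x y : V}, (x ⟶ y) → x ∈ S → y ∈ T → False) (hS : IsFinitelyPresented (ind k S))
    (hT : IsFinitelyPresented (ind k T)) : IsFinitelyPresented (ind k U) := by
  obtain ⟨X, hX, h₁, h₂, h₃⟩ := exists_shortExact_ind k hU hd h
  rw [← h₂]
  exact IsFinitelyPresented.extension hX (h₁ ▸ hS) (h₃ ▸ hT)

/-- Divide `P_b` by its left part. The remaining ray serves as the tail of an unbounded interval. -/
theorem isFinitelyPresented_ind_reach_ge {pos : V → ℤ} (hV : LinePos pos) (b : V) :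
    IsFinitelyPresented (ind k {x ∈ reach b | pos b ≤ pos x}) := by
  refine IsFinitelyPresented.ind_quotient (S := {x ∈ reach b | pos x < pos b}) (U := reach b)
    ?_ ?_ ?_ (projLF_ind_reach_below hV b) (.of_projLF (projLF_ind_reach hV b))
  · ext x
    simp only [Set.mem_union, Set.mem_ofPred_eq, ← and_or_left]
    exact (and_iff_left (lt_or_ge _ _)).symm
  · exact Set.disjoint_left.2 fun x h h' => absurd h.2 (not_lt.2 h'.2)
  · rintro x y α ⟨⟨p⟩, hx⟩ ⟨-, hy⟩
    have := hV.path_arrow p α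
    omega

/-- Dividing the ray further by its part strictly to the right of `b` leaves the simple
representation at `b`. -/
theorem isFinitelyPresented_ind_singleton {pos : V → ℤ} (hV : LinePos pos) (b : V) :
    IsFinitelyPresented (ind k {b}) := by
  refine IsFinitelyPresented.ind_quotient (S := {x ∈ reach b | pos b < pos x})
    (U := {x ∈ reach b | pos b ≤ pos x})
    ?_ ?_ ?_ (projLF_ind_reach_above hV b) (isFinitelyPresented_ind_reach_ge hV b)
  · ext x
    constructor
    · rintro ⟨h, h'⟩
      rcases h'.lt_or_eq with h' | h'
      · exact Or.inl ⟨h, h'⟩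
      · exact Or.inr (hV.inj h'.symm)
    · rintro (⟨h, h'⟩ | rfl)
      · exact ⟨h, h'.le⟩
      · exact ⟨self_mem_reach _, le_rfl⟩
  · rw [Set.disjoint_singleton_right]
    exact fun h => lt_irrefl _ h.2
  · rintro x y α ⟨⟨p⟩, hx⟩ rfl
    have := hV.path_arrow p α
    omega

end Line

/-! ### Indicator representations of intervals -/

section Interval

variable {V : Type u} [Quiver.{v} V]

/-- The set is an interval with respect to the positions of the vertices. -/
def IsInterval (pos : V → ℤ) (S : Set V) : Prop :=
  ∀ {x y z : V}, x ∈ S → z ∈ S → pos x ≤ pos y → pos y ≤ pos z → y ∈ S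

omit [Quiver.{v} V] in
theorem IsInterval.neg {pos : V → ℤ} {S : Set V} (h : IsInterval pos S) :
    IsInterval (fun x => - pos x) S :=
  fun {_ _ _} hx hz hxy hyz => h hz hx (neg_le_neg_iff.1 hyz) (neg_le_neg_iff.1 hxy)

variable {k : Type w} [Field k] {pos : V → ℤ}

/-- At most one arrow crosses the cut. Its direction decides which half is the subrepresentation and
which the quotient. -/
theorem isFinitelyPresented_ind_of_cut (hV : LinePos pos) (S : Set V) (q : ℤ)
    (h₁ : IsFinitelyPresented (ind k {x ∈ S | q ≤ pos x}))
    (h₂ : IsFinitelyPresented (ind k {x ∈ S | pos x < q})) : IsFinitelyPresented (ind k S) := by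
  have hS : S = {x ∈ S | q ≤ pos x} ∪ {x ∈ S | pos x < q} := by
    ext x
    simp only [Set.mem_union, Set.mem_ofPred_eq, ← and_or_left]
    exact (and_iff_left (le_or_gt _ _)).symm
  have hd : Disjoint {x ∈ S | q ≤ pos x} {x ∈ S | pos x < q} :=
    Set.disjoint_left.2 fun x h h' => absurd h.2 (not_le.2 h'.2)
  by_cases h : ∃ x y : V, Nonempty (x ⟶ y) ∧ q ≤ pos x ∧ pos y < q
  · obtain ⟨x, y, ⟨α⟩, hx, hy⟩ := h
    refine IsFinitelyPresented.ind_extension (hS.trans (Set.union_comm _ _)) hd.symm ?_ h₂ h₁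
    rintro x' y' β ⟨-, hx'⟩ ⟨-, hy'⟩
    have h₁ := hV.step α
    have h₂ := hV.step β
    have h₃ : x' = y := hV.inj (by omega)
    have h₄ : y' = x := hV.inj (by omega)
    subst h₃ h₄
    exact hV.antisymm α β
  · refine IsFinitelyPresented.ind_extension hS hd ?_ h₁ h₂
    rintro x y α ⟨-, hx⟩ ⟨-, hy⟩
    exact h ⟨x, y, ⟨α⟩, hx, hy⟩

theorem isFinitelyPresented_ind_of_subsingleton (hV : LinePos pos) {S : Set V}
    (h : S.Subsingleton) : IsFinitelyPresented (ind k S) := by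
  rcases h.eq_empty_or_singleton with rfl | ⟨b, rfl⟩
  · exact .of_projLF projLF_ind_empty
  · exact isFinitelyPresented_ind_singleton hV b

/-- Each step to the left adds at most one vertex, that is, extends by a simple representation or by
zero. -/
theorem isFinitelyPresented_ind_ge_of_le (hV : LinePos pos) (S : Set V) {q : ℤ}
    (h : IsFinitelyPresented (ind k {x ∈ S | q ≤ pos x})) {q' : ℤ} (hq : q' ≤ q) :
    IsFinitelyPresented (ind k {x ∈ S | q' ≤ pos x}) := by
  induction q', hq using Int.leInductionDown with
  | base => exact h
  | pred n hn ih =>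
    refine isFinitelyPresented_ind_of_cut hV _ n ?_ ?_
    · convert! ih using 3
      ext x
      simp only [Set.mem_ofPred_eq]
      constructor
      · exact fun h => ⟨h.1.1, h.2⟩
      · exact fun h => ⟨⟨h.1, by omega⟩, h.2⟩
    · refine isFinitelyPresented_ind_of_subsingleton hV ?_
      rintro x ⟨⟨-, h₁⟩, h₂⟩ y ⟨⟨-, h₃⟩, h₄⟩
      exact hV.inj (by omega)

/-- If `S` is bounded above, an empty tail will do. Otherwise, beyond the last sink or source, the
arrows cannot all point inwards without forming a left infinite path, so they point outwards and the
tail is a ray. -/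
theorem exists_isFinitelyPresented_ind_ge (hV : LinePos pos) {S : Set V} (hS : IsInterval pos S)
    (hfin : {x | IsSinkIn S x ∨ IsSourceIn S x}.Finite) (hpath : ¬ HasLeftInfinitePath S) (C : ℤ) :
    ∃ q : ℤ, C ≤ q ∧ IsFinitelyPresented (ind k {x ∈ S | q ≤ pos x}) := by
  by_cases hb : ∃ q, ∀ x ∈ S, pos x < q
  · obtain ⟨q, hq⟩ := hb
    refine ⟨max C q, le_max_left _ _, isFinitelyPresented_ind_of_subsingleton hV ?_⟩
    rintro x ⟨h, h'⟩
    have := hq x h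
    exact absurd h' (by omega)
  push Not at hb
  obtain ⟨B, hB⟩ := (hfin.image pos).bddAbove
  obtain ⟨b, hbS, hb'⟩ := hb (max C (B + 1))
  have hmem : ∀ {x}, pos b ≤ pos x → x ∈ S := by
    intro x hx
    obtain ⟨z, hz, hz'⟩ := hb (pos x)
    exact hS hbS hz hx hz'
  have hex : ∀ n : ℕ, ∃ x, pos x = pos b + n := by
    intro n
    obtain ⟨z, hz, hz'⟩ := hb (pos b + n)
    exact hV.exists_between (x := b) (by omega) hz'
  choose x hx using hex
  have hxS : ∀ n, x n ∈ S := fun n => hmem (by rw [hx]; omega)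
  have hsource : ∀ n, ¬ IsSourceIn S (x n) := by
    intro n hn
    have := hB ⟨x n, Or.inr hn, rfl⟩
    rw [hx] at this
    omega
  -- One inward arrow would force all later ones to be inward, since the first outward one after it
  -- would start at a source.
  have hright : ∀ n, Nonempty (x n ⟶ x (n + 1)) := by
    by_contra! hc
    obtain ⟨n, hn⟩ := hc
    refine hpath ⟨fun m => x (n + m), fun m => hxS _, fun m => ?_⟩
    induction m with
    | zero =>
      exact (hV.total (x := x n) (y := x (n + 1)) (by rw [hx, hx]; push_cast; omega)).resolve_left
        (not_nonempty_iff.2 hn)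
    | succ m ih =>
      obtain ⟨α⟩ := ih
      refine (hV.total (x := x (n + (m + 1))) (y := x (n + (m + 1) + 1))
        (by rw [hx, hx]; push_cast; omega)).resolve_left ?_
      rintro ⟨β⟩
      refine hsource (n + (m + 1)) ⟨hxS _, fun y _ => ⟨fun γ => ?_⟩⟩
      have h₁ := hx (n + (m + 1))
      have h₂ := hx (n + m)
      have h₃ := hx (n + (m + 1) + 1)
      push_cast at h₁ h₂ h₃
      rcases hV.step γ with h | h
      · have : y = x (n + m) := hV.inj (by omega)
        subst this
        exact hV.antisymm α γ
      · have : y = x (n + (m + 1) + 1) := hV.inj (by omega)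
        subst this
        exact hV.antisymm β γ
  refine ⟨pos b, by omega, ?_⟩
  convert! isFinitelyPresented_ind_reach_ge hV b using 3
  ext z
  refine ⟨fun h => ⟨?_, h.2⟩, fun h => ⟨hmem h.2, h.2⟩⟩
  have hr : ∀ n, x n ∈ reach b := by
    intro n
    induction n with
    | zero =>
      rw [hV.inj (show pos (x 0) = pos b by rw [hx]; simp)]
      exact self_mem_reach b
    | succ n ih =>
      obtain ⟨α⟩ := hright n
      exact reach_of_arrow ih α
  have h2 : pos b ≤ pos z := h.2
  rw [hV.inj (show pos z = pos (x (pos z - pos b).toNat) by rw [hx]; omega)]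
  exact hr _

theorem isFinitelyPresented_ind (hV : LinePos pos) {S : Set V} (hS : IsInterval pos S)
    (hfin : {x | IsSinkIn S x ∨ IsSourceIn S x}.Finite) (hpath : ¬ HasLeftInfinitePath S) :
    IsFinitelyPresented (ind k S) := by
  obtain ⟨r, -, hr⟩ := exists_isFinitelyPresented_ind_ge (k := k) hV.neg hS.neg hfin hpath 0
  -- The bound `1 - r ≤ q` makes the half `pos x < q`, that is `1 - q ≤ -pos x`, contain the left
  -- tail `r ≤ -pos x`; the vertices between are then added one by one.
  obtain ⟨q, hqr, hq⟩ := exists_isFinitelyPresented_ind_ge (k := k) hV hS hfin hpath (1 - r)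
  refine isFinitelyPresented_ind_of_cut hV S q hq ?_
  convert! isFinitelyPresented_ind_ge_of_le hV.neg S hr (q' := 1 - q) (by omega) using 3
  ext x
  exact and_congr_right fun _ => by omega

end Interval

/-! ### Walks -/

section Walk

variable {V : Type u} [Quiver.{v} V] {pos : V → ℤ}

theorem LinePos.step_edge (hV : LinePos pos) (c : Edge V) :
    pos c.finish = pos c.start + 1 ∨ pos c.start = pos c.finish + 1 := by
  cases c with
  | arrow α => exact hV.step α
  | inv α => exact (hV.step α).symm

theorem LinePos.edge_ext (hV : LinePos pos) {c d : Edge V} (h₁ : c.start = d.start)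
    (h₂ : c.finish = d.finish) : c = d := by
  cases c with
  | @arrow x y α =>
    cases d with
    | @arrow x' y' β =>
      change x = x' at h₁
      change y = y' at h₂
      subst h₁ h₂
      rw [(hV.subsingleton _ _).elim α β]
    | @inv x' y' β =>
      change x = y' at h₁
      change y = x' at h₂
      subst h₁ h₂
      exact (hV.antisymm α β).elim
  | @inv x y α =>
    cases d with
    | @arrow x' y' β =>
      change y = x' at h₁
      change x = y' at h₂
      subst h₁ h₂
      exact (hV.antisymm α β).elim
    | @inv x' y' β =>
      change y = y' at h₁
      change x = x' at h₂
      subst h₁ h₂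
      rw [(hV.subsingleton _ _).elim α β]

namespace Edge

theorem start_inverse (c : Edge V) : c.inverse.start = c.finish := by cases c <;> rfl

theorem finish_inverse (c : Edge V) : c.inverse.finish = c.start := by cases c <;> rfl

end Edge

theorem LinePos.eq_arrow_or_inv (hV : LinePos pos) {c : Edge V} {x y : V} (α : x ⟶ y)
    (h : c.start = x ∧ c.finish = y ∨ c.start = y ∧ c.finish = x) :
    c = Edge.arrow α ∨ c = Edge.inv α := by
  rcases h with ⟨h₁, h₂⟩ | ⟨h₁, h₂⟩
  · exact Or.inl (hV.edge_ext h₁ h₂)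
  · exact Or.inr (hV.edge_ext h₁ h₂)

/-- The positions of the vertices of a reduced walk are monotone. -/
theorem LinePos.exists_pos_start (hV : LinePos pos) {I : Set ℤ} {hne : I.Nonempty}
    {hI : I.OrdConnected} {c : I → Edge V}
    {hc : ∀ i j : I, (j : ℤ) = i + 1 → (c i).finish = (c j).start}
    (hred : (Walk.nontrivial I hne hI c hc).IsReduced) :
    ∃ ε d : ℤ, (ε = 1 ∨ ε = -1) ∧ ∀ i : I, pos (c i).start = d + ε * i ∧
      pos (c i).finish = d + ε * (i + 1) := by
  -- Consecutive edges with opposite increments have the same endpoints reversed, hence are inverse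
  -- to each other, which reducedness excludes.
  have hred' : ∀ i j : I, (j : ℤ) = i + 1 →
      pos (c j).finish - pos (c j).start = pos (c i).finish - pos (c i).start := by
    intro i j hij
    have h₁ := hc i j hij
    have h₂ := hV.step_edge (c i)
    have h₃ := hV.step_edge (c j)
    have h₄ := hred i j hij
    rw [← h₁] at h₃ ⊢
    by_contra hne
    refine h₄ (hV.edge_ext ?_ ?_)
    · rw [Edge.start_inverse, h₁]
    · rw [Edge.finish_inverse]
      exact hV.inj (by omega)
  obtain ⟨i₀, hi₀⟩ := hne
  obtain ⟨ε, hε⟩ : ∃ ε, ε = pos (c ⟨i₀, hi₀⟩).finish - pos (c ⟨i₀, hi₀⟩).start := ⟨_, rfl⟩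
  have up : ∀ n : ℕ, ∀ h : i₀ + n ∈ I, pos (c ⟨_, h⟩).start = pos (c ⟨i₀, hi₀⟩).start + ε * n ∧
      pos (c ⟨_, h⟩).finish - pos (c ⟨_, h⟩).start = ε := by
    intro n
    induction n with
    | zero =>
      intro h
      have : (⟨i₀ + (0 : ℕ), h⟩ : I) = ⟨i₀, hi₀⟩ := Subtype.ext (by simp)
      rw [this, hε]
      simp
    | succ n ih =>
      intro h
      have h' : i₀ + n ∈ I := hI.out hi₀ h ⟨by omega, by push_cast; omega⟩
      obtain ⟨h₁, h₂⟩ := ih h'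
      have h₃ := hc ⟨_, h'⟩ ⟨_, h⟩ (by push_cast; ring)
      have h₄ := hred' ⟨_, h'⟩ ⟨_, h⟩ (by push_cast; ring)
      rw [h₂] at h₄
      refine ⟨?_, h₄⟩
      rw [← h₃]
      push_cast
      linarith
  have down : ∀ n : ℕ, ∀ h : i₀ - n ∈ I, pos (c ⟨_, h⟩).start = pos (c ⟨i₀, hi₀⟩).start - ε * n ∧
      pos (c ⟨_, h⟩).finish - pos (c ⟨_, h⟩).start = ε := by
    intro n
    induction n with
    | zero =>
      intro h
      have : (⟨i₀ - (0 : ℕ), h⟩ : I) = ⟨i₀, hi₀⟩ := Subtype.ext (by simp)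
      rw [this, hε]
      simp
    | succ n ih =>
      intro h
      have h' : i₀ - n ∈ I := hI.out h hi₀ ⟨by push_cast; omega, by omega⟩
      obtain ⟨h₁, h₂⟩ := ih h'
      have h₃ := hc ⟨_, h⟩ ⟨_, h'⟩ (by push_cast; ring)
      have h₄ := hred' ⟨_, h⟩ ⟨_, h'⟩ (by push_cast; ring)
      rw [h₂] at h₄
      refine ⟨?_, h₄.symm⟩
      rw [← h₃] at h₁
      have h₅ : ε * ((n + 1 : ℕ) : ℤ) = ε * n + ε := by push_cast; ring
      rw [h₅]
      linarith
  -- Here `d` is the position extrapolated to index `0`, which need not lie in `I`.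
  refine ⟨ε, pos (c ⟨i₀, hi₀⟩).start - ε * i₀, ?_, fun i => ?_⟩
  · have := hV.step_edge (c ⟨i₀, hi₀⟩)
    omega
  · rcases le_total i₀ i with h | h
    · have he : (⟨i₀ + (i - i₀ : ℤ).toNat, by
        rw [Int.toNat_of_nonneg (by omega)]; simp⟩ : I) = i :=
        Subtype.ext (by simp only; omega)
      have := up (i - i₀ : ℤ).toNat (by rw [Int.toNat_of_nonneg (by omega)]; simp)
      rw [he, Int.toNat_of_nonneg (by omega)] at this
      constructor <;> linarith [this.1, this.2]
    · have he : (⟨i₀ - (i₀ - i : ℤ).toNat, by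
        rw [Int.toNat_of_nonneg (by omega)]; simp⟩ : I) = i :=
        Subtype.ext (by simp only; omega)
      have := down (i₀ - i : ℤ).toNat (by rw [Int.toNat_of_nonneg (by omega)]; simp)
      rw [he, Int.toNat_of_nonneg (by omega)] at this
      constructor <;> linarith [this.1, this.2]

theorem LinePos.verts_isInterval (hV : LinePos pos) {p : Walk V} (hp : p.IsReduced) :
    IsInterval pos p.verts := by
  cases p with
  | trivial a =>
    rintro x y z (rfl : x = a) (rfl : z = x) h₁ h₂
    exact hV.inj (le_antisymm h₂ h₁)
  | nontrivial I hne hI c hc =>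
    obtain ⟨ε, d, hε, h⟩ := hV.exists_pos_start hp
    -- Number vertices so that edge `c a` runs from vertex `a` to vertex `a + 1`; vertex `a` then
    -- appears when `a ∈ I` (as a start) or `a - 1 ∈ I` (as a finish).
    have hmem : ∀ {x}, x ∈ (Walk.nontrivial I hne hI c hc).verts →
        ∃ a : ℤ, pos x = d + ε * a ∧ (a ∈ I ∨ a - 1 ∈ I) := by
      rintro x ⟨i, rfl | rfl⟩
      · exact ⟨i, (h i).1, Or.inl i.2⟩
      · exact ⟨i + 1, (h i).2, Or.inr (by simp)⟩
    have hmem' : ∀ {x} {a : ℤ}, pos x = d + ε * a → (a ∈ I ∨ a - 1 ∈ I) →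
        x ∈ (Walk.nontrivial I hne hI c hc).verts := by
      rintro x a hx (ha | ha)
      · exact ⟨⟨a, ha⟩, Or.inl (hV.inj (hx.trans (h ⟨a, ha⟩).1.symm))⟩
      · exact ⟨⟨a - 1, ha⟩, Or.inr (hV.inj (hx.trans (by rw [(h ⟨a - 1, ha⟩).2]; simp)))⟩
    have hin : ∀ {a b m : ℤ}, (a ∈ I ∨ a - 1 ∈ I) → (b ∈ I ∨ b - 1 ∈ I) → a ≤ m → m ≤ b →
        (m ∈ I ∨ m - 1 ∈ I) := by
      intro a b m ha hb h₁ h₂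
      by_cases h₃ : m = a
      · rwa [h₃]
      by_cases h₄ : m = b
      · rwa [h₄]
      · rcases ha with ha | ha <;> rcases hb with hb | hb
        · exact Or.inl (hI.out ha hb ⟨by omega, by omega⟩)
        · exact Or.inl (hI.out ha hb ⟨by omega, by omega⟩)
        · exact Or.inl (hI.out ha hb ⟨by omega, by omega⟩)
        · exact Or.inl (hI.out ha hb ⟨by omega, by omega⟩)
    intro x y z hx hz hxy hyz
    obtain ⟨a, hxa, ha⟩ := hmem hx
    obtain ⟨b, hzb, hb⟩ := hmem hz
    rcases hε with rfl | rfl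
    · exact hmem' (a := pos y - d) (by ring) (hin ha hb (by omega) (by omega))
    · exact hmem' (a := d - pos y) (by ring) (hin hb ha (by omega) (by omega))

/-- Neighbouring vertices of a reduced walk have consecutive indices, so the edge between them
belongs to the walk. Consequently `M(w)` depends only on the vertex set. -/
theorem LinePos.hasArrow (hV : LinePos pos) {p : Walk V} (hp : p.IsReduced) {x y : V} (α : x ⟶ y)
    (hx : x ∈ p.verts) (hy : y ∈ p.verts) : p.HasArrow α := by
  cases p with
  | trivial a =>
    obtain rfl : x = a := hx
    obtain rfl : y = x := hy
    exact (hV.antisymm α α).elim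
  | nontrivial I hne hI c hc =>
    obtain ⟨ε, d, hε, h⟩ := hV.exists_pos_start hp
    have hmem : ∀ {x}, x ∈ (Walk.nontrivial I hne hI c hc).verts →
        ∃ a : ℤ, pos x = d + ε * a ∧ (a ∈ I ∨ a - 1 ∈ I) := by
      rintro x ⟨i, rfl | rfl⟩
      · exact ⟨i, (h i).1, Or.inl i.2⟩
      · exact ⟨i + 1, (h i).2, Or.inr (by simp)⟩
    have key : ∀ {x y : V} {a b : ℤ}, pos x = d + ε * a → (a ∈ I ∨ a - 1 ∈ I) →
        pos y = d + ε * b → (b ∈ I ∨ b - 1 ∈ I) → b = a + 1 →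
        ∃ i, (c i).start = x ∧ (c i).finish = y := by
      rintro x y a b hx ha hy hb rfl
      have ha' : a ∈ I := by
        rcases ha with ha | ha
        · exact ha
        rcases hb with hb | hb
        · exact hI.out ha hb ⟨by omega, by omega⟩
        · simpa using hb
      exact ⟨⟨a, ha'⟩, hV.inj ((h _).1.trans hx.symm), hV.inj ((h _).2.trans hy.symm)⟩
    obtain ⟨a, hxa, ha⟩ := hmem hx
    obtain ⟨b, hyb, hb⟩ := hmem hy
    have hstep := hV.step α
    have hab : b = a + 1 ∨ a = b + 1 := by
      rcases hε with rfl | rfl <;> omega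
    rcases hab with hab | hab
    · obtain ⟨i, hi⟩ := key hxa ha hyb hb hab
      exact ⟨i, hV.eq_arrow_or_inv α (Or.inl hi)⟩
    · obtain ⟨i, hi⟩ := key hyb hb hxa ha hab
      exact ⟨i, hV.eq_arrow_or_inv α (Or.inr hi)⟩

/-- Every nonempty interval is the set of vertices of a reduced walk. -/
theorem LinePos.exists_walk (hV : LinePos pos) {S : Set V} (hS : IsInterval pos S)
    (hne : S.Nonempty) : ∃ p : Walk V, p.IsReduced ∧ p.verts = S := by
  obtain ⟨a, ha⟩ := hne
  by_cases hsub : S = {a}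
  · exact ⟨Walk.trivial a, trivial, hsub.symm⟩
  -- The walk runs from left to right, each edge being indexed by the position of its left end. A
  -- singleton `S` contains no edge and was given the trivial walk.
  let I : Set ℤ := {n | ∃ c : Edge V, pos c.start = n ∧ pos c.finish = n + 1 ∧
    c.start ∈ S ∧ c.finish ∈ S}
  have hedge : ∀ {x y : V}, x ∈ S → y ∈ S → pos y = pos x + 1 →
      ∃ c : Edge V, c.start = x ∧ c.finish = y := by
    intro x y hx hy hxy
    rcases hV.total hxy with ⟨⟨α⟩⟩ | ⟨⟨α⟩⟩
    · exact ⟨Edge.arrow α, rfl, rfl⟩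
    · exact ⟨Edge.inv α, rfl, rfl⟩
  have hI : ∀ {x y : V}, x ∈ S → y ∈ S → pos y = pos x + 1 → pos x ∈ I := by
    intro x y hx hy hxy
    obtain ⟨c, rfl, rfl⟩ := hedge hx hy hxy
    exact ⟨c, rfl, hxy, hx, hy⟩
  have hnext : ∀ {x z : V}, x ∈ S → z ∈ S → pos x < pos z → ∃ y ∈ S, pos y = pos x + 1 := by
    intro x z hx hz hxz
    obtain ⟨y, hy⟩ := hV.exists_between (x := x) (y := z) (n := pos x + 1) (by omega) (by omega)
    exact ⟨y, hS hx hz (by omega) (by omega), hy⟩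
  have hprev : ∀ {x z : V}, x ∈ S → z ∈ S → pos x < pos z → ∃ y ∈ S, pos z = pos y + 1 := by
    intro x z hx hz hxz
    obtain ⟨y, hy⟩ := hV.exists_between (x := x) (y := z) (n := pos z - 1) (by omega) (by omega)
    exact ⟨y, hS hx hz (by omega) (by omega), by omega⟩
  choose c hc₁ hc₂ hc₃ hc₄ using fun i : I => i.2
  obtain ⟨b, hb, hba⟩ : ∃ b ∈ S, b ≠ a := by
    by_contra! hc
    exact hsub (Set.eq_singleton_iff_unique_mem.2 ⟨ha, hc⟩)
  have hmem : ∀ x ∈ S, ∃ i, x = (c i).start ∨ x = (c i).finish := by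
    intro x hx
    obtain ⟨z, hz, hzx⟩ : ∃ z ∈ S, z ≠ x := by
      by_cases hax : a = x
      · exact ⟨b, hb, hax ▸ hba⟩
      · exact ⟨a, ha, hax⟩
    rcases lt_or_gt_of_ne (fun h => hzx (hV.inj h)) with h | h
    · obtain ⟨y, hy, hyx⟩ := hprev hz hx h
      exact ⟨⟨pos y, hI hy hx hyx⟩, Or.inr (hV.inj (by rw [hc₂, hyx]))⟩
    · obtain ⟨y, hy, hyx⟩ := hnext hx hz h
      exact ⟨⟨pos x, hI hx hy hyx⟩, Or.inl (hV.inj (by rw [hc₁]))⟩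
  refine ⟨Walk.nontrivial I ?_ ?_ c ?_, ?_, ?_⟩
  · obtain ⟨i, -⟩ := hmem a ha
    exact ⟨i, i.2⟩
  · refine ⟨fun m hm n hn l hl => ?_⟩
    obtain ⟨hl₁, hl₂⟩ := hl
    have h₁ := hc₁ ⟨m, hm⟩
    have h₂ := hc₂ ⟨n, hn⟩
    dsimp only at h₁ h₂
    obtain ⟨x, hx⟩ := hV.exists_between (x := (c ⟨m, hm⟩).start) (y := (c ⟨n, hn⟩).finish) (n := l)
      (by omega) (by omega)
    obtain ⟨y, hy⟩ := hV.exists_between (x := (c ⟨m, hm⟩).start) (y := (c ⟨n, hn⟩).finish)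
      (n := l + 1) (by omega) (by omega)
    rw [← hx]
    have h₃ := hc₂ ⟨n, hn⟩
    dsimp only at h₃
    exact hI (hS (y := x) (hc₃ ⟨m, hm⟩) (hc₄ ⟨n, hn⟩) (by omega) (by omega))
      (hS (y := y) (hc₃ ⟨m, hm⟩) (hc₄ ⟨n, hn⟩) (by omega) (by omega)) (by omega)
  · intro i j hij
    exact hV.inj (by rw [hc₁, hc₂, hij])
  · intro i j hij h
    have h₁ := hc₂ j
    rw [h, Edge.finish_inverse, hc₁] at h₁
    omega
  · ext x
    refine ⟨?_, hmem x⟩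
    rintro ⟨i, rfl | rfl⟩
    exacts [hc₃ i, hc₄ i]

variable (k : Type w) [Field k]

theorem stringSpace_eq_indSpace (p : Walk V) (x : V) :
    stringSpace k p x = indSpace k (ULift.{max u v} k) p.verts x := by
  unfold stringSpace
  ext c
  by_cases h : x ∈ p.verts
  · rw [if_pos h]
    exact ⟨fun _ h' => absurd h h', fun _ => Submodule.mem_top⟩
  · rw [if_neg h, Submodule.mem_bot]
    exact ⟨fun hc _ => hc, fun hc => hc h⟩

/-- The string representation of a reduced walk is the indicator representation of its set of
vertices. -/
theorem LinePos.nonempty_stringRep_iso (hV : LinePos pos) {p : Walk V} (hp : p.IsReduced) :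
    Nonempty (stringRep k p ≅ ind k p.verts) := by
  let f : stringRep k p ⟶ ind k p.verts :=
    mkHom (fun x => ModuleCat.ofHom
      (LinearEquiv.ofEq _ _ (stringSpace_eq_indSpace k p x)).toLinearMap) (by
      intro x y α
      rw [ind_act]
      have : (stringRep k p).act α = _ := Paths.lift_toPath _ α
      rw [this]
      by_cases hx : x ∈ p.verts
      · by_cases hy : y ∈ p.verts
        · have hα := hV.hasArrow hp α hx hy
          refine (congrArg (· ≫ _) (dif_pos hα)).trans ?_
          refine congrArg ModuleCat.ofHom (LinearMap.ext fun c => Subtype.ext ?_)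
          exact (indMap_of_mem hy (⟨c.1, fun h => absurd hx h⟩ : indSpace k _ p.verts x)).symm
        · ext c
          exact (indSpace_eq_zero hy _).trans (indSpace_eq_zero hy _).symm
      · ext (c : stringSpace k p x)
        have hc : c = 0 := by
          have h : ∀ d ∈ stringSpace k p x, d = 0 := by
            rw [stringSpace_eq_indSpace]
            exact fun d hd => hd hx
          exact Subtype.ext (h c.1 c.2)
        rw [hc]
        exact (map_zero _).trans (map_zero _).symm)
  have : IsIso f := isIso_of_app f fun x =>
    (LinearEquiv.ofEq _ _ (stringSpace_eq_indSpace k p x)).bijective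
  exact ⟨asIso f⟩

end Walk

/-! ### Behaviour of finitely presented representations far away -/

section Stable

variable {k : Type w} [Field k] {V : Type u} [Quiver.{v} V]

/-- Beyond the position `N`, arrows pointing away act as isomorphisms and arrows pointing back start
at a zero space. -/
def IsStableFrom (pos : V → ℤ) (M : Representation k V) (N : ℤ) : Prop :=
  ∀ {x y : V} (α : x ⟶ y), (N ≤ pos x → pos y = pos x + 1 → IsIso (M.act α)) ∧
    (N ≤ pos y → pos x = pos y + 1 → IsZero (M.obj ((Paths.of V).obj x)))

variable {pos : V → ℤ}

theorem IsStableFrom.mono {M : Representation k V} {N N' : ℤ} (h : IsStableFrom pos M N)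
    (hN : N ≤ N') : IsStableFrom pos M N' :=
  fun α => ⟨fun h' => (h α).1 (hN.trans h'), fun h' => (h α).2 (hN.trans h')⟩

theorem IsStableFrom.of_iso {M M' : Representation k V} {N : ℤ} (h : IsStableFrom pos M N)
    (e : M ≅ M') : IsStableFrom pos M' N := by
  intro x y α
  refine ⟨fun h₁ h₂ => ?_, fun h₁ h₂ => ((h α).2 h₁ h₂).of_iso (e.app _).symm⟩
  have := (h α).1 h₁ h₂
  have h₃ : M'.act α = e.inv.app _ ≫ M.act α ≫ e.hom.app _ := by
    rw [NatTrans.naturality, Iso.inv_hom_id_app_assoc]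
  rw [h₃]
  infer_instance

/-- To the right of `a`, appending an outward arrow is a bijection on paths from `a`, while the
start of an inward arrow cannot be reached from `a`. -/
theorem isStableFrom_projTensor (hV : LinePos pos) (a : V) (U : ModuleCat.{max u v w} k) :
    IsStableFrom pos (projTensor a U) (pos a) := by
  intro x y α
  refine ⟨fun h₁ h₂ => ?_, fun h₁ h₂ => ?_⟩
  · rw [ConcreteCategory.isIso_iff_bijective]
    refine ⟨?_, fun z => ?_⟩
    · refine Module.Flat.rTensor_preserves_injective_linearMap (M := U)
        (Finsupp.lmapDomain k k
          fun p : (Paths.of V).obj a ⟶ (Paths.of V).obj x => p ≫ (Paths.of V).map α) ?_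
      exact Finsupp.mapDomain_injective fun p q _ => (hV.subsingleton_path a x).elim p q
    · refine projTensor_induction U
        (motive := fun z => ∃ t, (projTensor a U).act α t = z) z ⟨0, map_zero _⟩ ?_ ?_
      · rintro _ _ ⟨t, rfl⟩ ⟨t', rfl⟩
        exact ⟨t + t', map_add _ _ _⟩
      · intro p c
        have hp : ∀ _ : Quiver.Path a y, x ∈ reach a := by
          intro p
          cases p with
          | nil => omega
          | @cons b _ p β =>
            have := hV.path_arrow p β
            rw [hV.inj (show pos x = pos b by omega)]
            exact ⟨p⟩
        obtain ⟨q⟩ := hp p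
        refine ⟨projTensorMk U (x := (Paths.of V).obj x) q c, (projTensor_map_mk U _ _ _).trans ?_⟩
        exact congrArg (projTensorMk U · c) ((hV.subsingleton_path a y).elim _ _)
  · rw [ModuleCat.isZero_iff_subsingleton]
    have h0 : ∀ z : (projTensor a U).obj ((Paths.of V).obj x), z = 0 := fun z => by
      refine projTensor_induction U (motive := fun z => z = 0) z rfl ?_ ?_
      · rintro _ _ rfl rfl
        exact add_zero _
      · intro p c
        obtain ⟨β⟩ := hV.arrow_of_path_right p h₂ h₁ le_rfl
        exact (hV.antisymm α β).elim
    exact ⟨fun z z' => (h0 z).trans (h0 z').symm⟩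

instance : HasFiniteBiproducts (Representation k V) :=
  HasFiniteBiproducts.of_hasFiniteCoproducts

theorem isStableFrom_biproduct {n : ℕ} (P : Fin n → Representation k V) {N : ℤ}
    (h : ∀ i, IsStableFrom pos (P i) N) : IsStableFrom pos (⨁ P) N := by
  have htotal : ∀ x : Paths V, ∑ i, (biproduct.π P i).app x ≫ (biproduct.ι P i).app x = 𝟙 _ := by
    intro x
    have := congrArg (fun f => NatTrans.app f x) (biproduct.total (f := P))
    rw [NatTrans.app_sum] at this
    exact this
  intro x y α
  refine ⟨fun h₁ h₂ => ?_, fun h₁ h₂ => ?_⟩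
  · have := fun i => (h i α).1 h₁ h₂
    refine ⟨∑ i, (biproduct.π P i).app _ ≫ inv ((P i).act α) ≫ (biproduct.ι P i).app _, ?_, ?_⟩
    · rw [← htotal, Preadditive.comp_sum]
      refine Finset.sum_congr rfl fun i _ => ?_
      rw [NatTrans.naturality_assoc, IsIso.hom_inv_id_assoc]
    · rw [← htotal, Preadditive.sum_comp]
      refine Finset.sum_congr rfl fun i _ => ?_
      rw [Category.assoc, Category.assoc, ← NatTrans.naturality, IsIso.inv_hom_id_assoc]
  · rw [IsZero.iff_id_eq_zero, ← htotal]
    refine Finset.sum_eq_zero fun i _ => ?_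
    rw [((h i α).2 h₁ h₂).eq_of_tgt ((biproduct.π P i).app _) 0, zero_comp]

theorem IsProj.exists_isStableFrom (hV : LinePos pos) {P : Representation k V} (h : IsProj P) :
    ∃ N, IsStableFrom pos P N := by
  obtain ⟨n, a, U, ⟨e⟩⟩ := h
  obtain ⟨N, hN⟩ := Finite.exists_le fun i => pos (a i)
  refine ⟨N, ?_⟩
  refine IsStableFrom.of_iso (isStableFrom_biproduct _ fun i => ?_)
    (biproduct.isoCoproduct _ ≪≫ e.symm)
  exact IsStableFrom.mono (isStableFrom_projTensor hV (a i) (U i)) (hN i)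

/-- For outward arrows, the four lemma gives injectivity on the cokernel, and surjectivity descends
from `S.X₂`. -/
theorem IsStableFrom.of_shortExact {S : ShortComplex (Representation k V)} (hS : S.ShortExact)
    {N : ℤ} (h₁ : IsStableFrom pos S.X₁ N) (h₂ : IsStableFrom pos S.X₂ N) :
    IsStableFrom pos S.X₃ N := by
  intro x y α
  have hx := shortExact_iff_app.1 hS x
  have hy := shortExact_iff_app.1 hS y
  refine ⟨fun hN hxy => ?_, fun hN hxy => ?_⟩
  · let φ := S.mapNatTrans ((evaluation (Paths V) (ModuleCat.{max u v w} k)).map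
      ((Paths.of V).map α))
    have hφ₁ : IsIso φ.τ₁ := (h₁ α).1 hN hxy
    have hφ₂ : IsIso φ.τ₂ := (h₂ α).1 hN hxy
    have hg := hx.epi_g
    have hg' := hy.epi_g
    have hm : Mono φ.τ₃ := ShortComplex.mono_of_epi_of_epi_of_mono φ hy.exact hg
      inferInstance inferInstance
    have he : Epi φ.τ₃ := by
      have : Epi (S.g.app ((Paths.of V).obj x) ≫ S.X₃.act α) := by
        rw [← NatTrans.naturality]
        exact @epi_comp _ _ _ _ _ _ ((h₂ α).1 hN hxy).epi_of_iso _ hg'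
      exact epi_of_epi (S.g.app ((Paths.of V).obj x)) (S.X₃.act α)
    exact isIso_of_mono_of_epi φ.τ₃
  · have hg := hx.epi_g
    exact @IsZero.of_epi _ _ _ _ _ (S.g.app ((Paths.of V).obj x)) hg ((h₂ α).2 hN hxy)

theorem IsFinitelyPresented.exists_isStableFrom (hV : LinePos pos) {M : Representation k V}
    (h : IsFinitelyPresented M) : ∃ N, IsStableFrom pos M N := by
  obtain ⟨P₁, P₀, f, g, hfg, hS, h₁, -, h₀, -⟩ := h
  obtain ⟨N₁, hN₁⟩ := h₁.exists_isStableFrom hV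
  obtain ⟨N₀, hN₀⟩ := h₀.exists_isStableFrom hV
  exact ⟨max N₁ N₀, IsStableFrom.of_shortExact hS (IsStableFrom.mono hN₁ (le_max_left _ _))
    (IsStableFrom.mono hN₀ (le_max_right _ _))⟩

end Stable

/-! ### Finitely presented indicator representations -/

section Converse

variable {k : Type w} [Field k] {V : Type u} [Quiver.{v} V] {pos : V → ℤ}

theorem not_isZero_ind {S : Set V} {x : V} (h : x ∈ S) :
    ¬ IsZero ((ind k S).obj ((Paths.of V).obj x)) := by
  rw [ModuleCat.isZero_iff_subsingleton, not_subsingleton_iff_nontrivial]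
  exact nontrivial_indSpace (k := k) (L := ULift.{max u v} k) h

theorem notMem_of_isStableFrom_ind {S : Set V} {N : ℤ} (h : IsStableFrom pos (ind k S) N) {x y : V}
    (α : x ⟶ y) (hN : N ≤ pos y) (hxy : pos x = pos y + 1) : x ∉ S :=
  fun hx => not_isZero_ind (k := k) hx ((h α).2 hN hxy)

theorem not_exists_ascending_path {S : Set V} {N : ℤ} (h : IsStableFrom pos (ind k S) N) (x : ℕ → V)
    (hx : ∀ n, x n ∈ S) (hα : ∀ n, Nonempty (x (n + 1) ⟶ x n))
    (hpos : ∀ n, pos (x n) = pos (x 0) + n) : False := by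
  obtain ⟨α⟩ := hα (N - pos (x 0)).toNat
  have h₁ := hpos (N - pos (x 0)).toNat
  have h₂ := hpos ((N - pos (x 0)).toNat + 1)
  push_cast at h₂
  exact notMem_of_isStableFrom_ind h α (by omega) (by omega) (hx _)

/-- Such a path cannot turn back, so followed backwards it runs off to one end. Its arrows there
point inwards, and stability makes the spaces at their starts zero. -/
theorem not_hasLeftInfinitePath (hV : LinePos pos) {S : Set V} {N N' : ℤ}
    (h : IsStableFrom pos (ind k S) N) (h' : IsStableFrom (fun x => - pos x) (ind k S) N') :
    ¬ HasLeftInfinitePath S := by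
  rintro ⟨x, hx, hα⟩
  have hturn : ∀ n, pos (x (n + 1 + 1)) - pos (x (n + 1)) = pos (x (n + 1)) - pos (x n) := by
    intro n
    obtain ⟨α⟩ := hα n
    obtain ⟨β⟩ := hα (n + 1)
    have h₁ := hV.step α
    have h₂ := hV.step β
    by_contra hne
    have : x (n + 1 + 1) = x n := hV.inj (by omega)
    rw [this] at β
    exact hV.antisymm α β
  obtain ⟨d, hd⟩ : ∃ d, d = pos (x 1) - pos (x 0) := ⟨_, rfl⟩
  have hdiff : ∀ n, pos (x (n + 1)) - pos (x n) = d := by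
    intro n
    induction n with
    | zero => exact hd.symm
    | succ n ih => exact (hturn n).trans ih
  obtain ⟨α⟩ := hα 0
  rcases hV.step α with h₁ | h₁
  · refine not_exists_ascending_path h' x hx hα fun n => ?_
    induction n with
    | zero => simp
    | succ n ih => have := hdiff n; push_cast; simp only [zero_add] at h₁; omega
  · refine not_exists_ascending_path h x hx hα fun n => ?_
    induction n with
    | zero => simp
    | succ n ih => have := hdiff n; push_cast; simp only [zero_add] at h₁; omega

/-- Beyond the stable range, a sink or source of an interval is the first or the last vertex. -/
theorem isLeast_or_isGreatest_of_isSinkIn_or_isSourceIn (hV : LinePos pos) {S : Set V}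
    (hS : IsInterval pos S) {N : ℤ} (h : IsStableFrom pos (ind k S) N) {x : V}
    (hx : IsSinkIn S x ∨ IsSourceIn S x) (hN : N < pos x) :
    IsLeast (pos '' S) (pos x) ∨ IsGreatest (pos '' S) (pos x) := by
  have hxS : x ∈ S := hx.elim (·.1) (·.1)
  by_contra! hc
  have h₁ : ∃ y ∈ S, pos y < pos x := by
    by_contra! h₁
    exact hc.1 ⟨⟨x, hxS, rfl⟩, by rintro _ ⟨y, hy, rfl⟩; exact h₁ y hy⟩
  have h₂ : ∃ y ∈ S, pos x < pos y := by
    by_contra! h₂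
    exact hc.2 ⟨⟨x, hxS, rfl⟩, by rintro _ ⟨y, hy, rfl⟩; exact h₂ y hy⟩
  obtain ⟨y, hy, hyx⟩ := h₁
  obtain ⟨z, hz, hxz⟩ := h₂
  obtain ⟨y', hy'⟩ := hV.exists_between (x := y) (y := x) (n := pos x - 1) (by omega) (by omega)
  obtain ⟨z', hz'⟩ := hV.exists_between (x := x) (y := z) (n := pos x + 1) (by omega) (by omega)
  have hy'S : y' ∈ S := hS hy hz (by omega) (by omega)
  have hz'S : z' ∈ S := hS hy hz (by omega) (by omega)
  -- An interior sink receives an inward arrow from `z'`, and an interior source sends one to `y'`;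
  -- both start at nonzero spaces. Strictness in `N < pos x` puts `y'` in the stable range.
  rcases hx with hx | hx
  · rcases hV.total hz' with ⟨⟨α⟩⟩ | ⟨⟨α⟩⟩
    · exact (hx.2 z' hz'S).elim α
    · exact notMem_of_isStableFrom_ind h α (by omega) hz' hz'S
  · rcases hV.total (x := y') (y := x) (by omega) with ⟨⟨α⟩⟩ | ⟨⟨α⟩⟩
    · exact (hx.2 y' hy'S).elim α
    · exact notMem_of_isStableFrom_ind h α (by omega) (by omega) hxS

theorem finite_sinks_sources (hV : LinePos pos) {S : Set V} (hS : IsInterval pos S) {N N' : ℤ}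
    (h : IsStableFrom pos (ind k S) N) (h' : IsStableFrom (fun x => - pos x) (ind k S) N') :
    {x | IsSinkIn S x ∨ IsSourceIn S x}.Finite := by
  have hfin : {n | IsLeast (pos '' S) n ∨ IsGreatest (pos '' S) n}.Finite := by
    refine Set.Finite.union (s := {n | IsLeast (pos '' S) n}) ?_ ?_
    · exact Set.Subsingleton.finite fun a ha b hb => IsLeast.unique ha hb
    · exact Set.Subsingleton.finite fun a ha b hb => IsGreatest.unique ha hb
  refine Set.Finite.subset (((Set.finite_Icc (-N') N).union hfin).preimage hV.inj.injOn) ?_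
  intro x hx
  by_cases h₁ : N < pos x
  · exact Or.inr (isLeast_or_isGreatest_of_isSinkIn_or_isSourceIn hV hS h hx h₁)
  by_cases h₂ : N' < - pos x
  · refine Or.inr ?_
    rcases isLeast_or_isGreatest_of_isSinkIn_or_isSourceIn hV.neg hS.neg h' hx h₂ with h₃ | h₃
    · refine Or.inr ⟨⟨x, hx.elim (·.1) (·.1), rfl⟩, ?_⟩
      rintro _ ⟨y, hy, rfl⟩
      exact neg_le_neg_iff.1 (h₃.2 ⟨y, hy, rfl⟩)
    · refine Or.inl ⟨⟨x, hx.elim (·.1) (·.1), rfl⟩, ?_⟩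
      rintro _ ⟨y, hy, rfl⟩
      exact neg_le_neg_iff.1 (h₃.2 ⟨y, hy, rfl⟩)
  · exact Or.inl ⟨by omega, by omega⟩

/-- Choosing predecessors forever would produce a left infinite path. This gives the nonemptiness
demanded by `IsString`. -/
theorem exists_isSourceIn {S : Set V} (hne : S.Nonempty) (h : ¬ HasLeftInfinitePath S) :
    ∃ x, IsSourceIn S x := by
  by_contra! hc
  have hpred : ∀ x : S, ∃ y : S, Nonempty (y.1 ⟶ x.1) := by
    intro x
    by_contra! hx
    exact hc x ⟨x.2, fun y hy => hx ⟨y, hy⟩⟩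
  choose f hf using hpred
  obtain ⟨a, ha⟩ := hne
  refine h ⟨fun n => (f^[n] ⟨a, ha⟩).1, fun n => (f^[n] ⟨a, ha⟩).2, fun n => ?_⟩
  simp only [Function.iterate_succ_apply']
  exact hf _

end Converse

/-! ### Splitting off an indicator representation -/

section Split

variable {k : Type w} [Field k] {V : Type u} [Quiver.{v} V]

/-- The space of a representation at a vertex. -/
abbrev Representation.space (M : Representation k V) (x : V) : ModuleCat.{max u v w} k :=
  M.obj ((Paths.of V).obj x)

/-- On the full subquiver with vertices `D`, the vectors `v x` define a morphism from the indicator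
representation of `S` to `M`, and the functionals `φ x` a retraction of it. -/
structure IsSplitting (M : Representation k V) (D S : Set V) (v : ∀ x, M.space x)
    (φ : ∀ x, M.space x →ₗ[k] k) : Prop where
  subset : S ⊆ D
  eq_one : ∀ x ∈ S, φ x (v x) = 1
  vec_eq_zero : ∀ x ∉ S, v x = 0
  dual_eq_zero : ∀ x ∉ S, φ x = 0
  map_vec : ∀ {x y : V} (α : x ⟶ y), x ∈ D → y ∈ D → x ∈ S → M.act α (v x) = v y
  comp_dual : ∀ {x y : V} (α : x ⟶ y), x ∈ D → y ∈ D → y ∈ S → (φ y).comp (M.act α).hom = φ x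

/-- The vectors give the inclusion and the functionals the retraction. At the boundary of `S`,
`map_vec` says that arrows leaving `S` kill `v x`, and `comp_dual` that `φ y` vanishes on the images
of arrows entering `S`. -/
theorem IsSplitting.exists_retract {M : Representation k V} {S : Set V} {v : ∀ x, M.space x}
    {φ : ∀ x, M.space x →ₗ[k] k} (h : IsSplitting M Set.univ S v φ) :
    ∃ (f : ind k S ⟶ M) (g : M ⟶ ind k S), f ≫ g = 𝟙 _ := by
  let F : ∀ x, indSpace k (ULift.{max u v} k) S x →ₗ[k] M.space x := fun x =>
    (LinearMap.toSpanSingleton k (M.space x) (v x)).comp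
      (ULift.moduleEquiv.toLinearMap.comp (indSpace k (ULift.{max u v} k) S x).subtype)
  let G : ∀ x, M.space x →ₗ[k] indSpace k (ULift.{max u v} k) S x := fun x =>
    LinearMap.codRestrict _ (ULift.moduleEquiv.symm.toLinearMap.comp (φ x)) fun m hx => by
      rw [h.dual_eq_zero x hx]; rfl
  have hF : ∀ x c, F x c = c.1.down • v x := fun x c => rfl
  have hG : ∀ x m, (G x m).1 = ULift.up (φ x m) := fun x m => rfl
  let f : ind k S ⟶ M := mkHom (fun x => ModuleCat.ofHom (F x)) (by
    intro x y α
    rw [ind_act]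
    ext (c : indSpace k (ULift.{max u v} k) S x)
    change F y (indMap S S x y c) = M.act α (F x c)
    rw [hF, hF, map_smul]
    by_cases hx : x ∈ S
    · rw [h.map_vec α trivial trivial hx]
      by_cases hy : y ∈ S
      · rw [indMap_of_mem hy]
      · rw [h.vec_eq_zero y hy, smul_zero, smul_zero]
    · rw [indSpace_eq_zero hx c, map_zero]
      exact (zero_smul _ _).trans (zero_smul _ _).symm)
  let g : M ⟶ ind k S := mkHom (fun x => ModuleCat.ofHom (G x)) (by
    intro x y α
    rw [ind_act]
    ext m
    change G y (M.act α m) = indMap S S x y (G x m)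
    refine Subtype.ext ?_
    by_cases hy : y ∈ S
    · rw [indMap_of_mem hy, hG, hG, ← h.comp_dual α trivial trivial hy]
      rfl
    · rw [indMap_of_notMem hy]
      exact (G y _).2 hy)
  refine ⟨f, g, ?_⟩
  have hGF : ∀ (x : V) (c : indSpace k (ULift.{max u v} k) S x), G x (F x c) = c := by
    intro x c
    refine Subtype.ext ?_
    by_cases hx : x ∈ S
    · rw [hG, hF, map_smul, h.eq_one x hx, smul_eq_mul, mul_one]
    · rw [c.2 hx]
      exact (G x _).2 hx
  ext x c
  exact hGF x c

variable {pos : V → ℤ} {M : Representation k V}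

open scoped Classical in
/-- The splitting data supported at one vertex. -/
theorem exists_isSplitting_singleton (hV : LinePos pos) (r : V) (a : M.space r)
    (ψ : M.space r →ₗ[k] k) (ha : ψ a = 1)
    (h₁ : ∀ {y : V} (α : r ⟶ y), pos y = pos r + 1 → M.act α a = 0)
    (h₂ : ∀ {y : V} (α : y ⟶ r), pos y = pos r + 1 → ψ.comp (M.act α).hom = 0) :
    ∃ S v φ, IsSplitting M {x | pos r ≤ pos x} S v φ ∧ IsInterval pos S ∧ r ∈ S ∧
      v r = a ∧ φ r = ψ := by
  refine ⟨{r}, Function.update (fun _ => 0) r a, Function.update (fun _ => 0) r ψ,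
    ⟨?_, ?_, ?_, ?_, ?_, ?_⟩, ?_, rfl, Function.update_self .., Function.update_self ..⟩
  · rintro x rfl
    exact le_refl (pos x)
  · rintro x rfl
    rwa [Function.update_self, Function.update_self]
  · exact fun x hx => Function.update_of_ne hx _ _
  · exact fun x hx => Function.update_of_ne hx _ _
  · rintro x y α - hy rfl
    have hy : pos x ≤ pos y := hy
    have := hV.step α
    have hne : y ≠ x := fun h => by subst h; omega
    rw [Function.update_self, Function.update_of_ne hne]
    exact h₁ α (by omega)
  · rintro x y α hx - rfl
    have hx : pos y ≤ pos x := hx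
    have := hV.step α
    have hne : x ≠ y := fun h => by subst h; omega
    rw [Function.update_self, Function.update_of_ne hne]
    exact h₂ α (by omega)
  · rintro x y z (rfl : x = r) (rfl : z = x) h₁ h₂
    exact hV.inj (le_antisymm h₂ h₁)

open scoped Classical in
/-- Splitting data can be extended by one vertex. -/
theorem IsSplitting.exists_insert (hV : LinePos pos) {r r' : V} (hr : pos r' = pos r + 1)
    {S : Set V} {v : ∀ x, M.space x} {φ : ∀ x, M.space x →ₗ[k] k}
    (h : IsSplitting M {x | pos r' ≤ pos x} S v φ) (hS : IsInterval pos S) (hrS : r' ∈ S)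
    (a : M.space r) (ψ : M.space r →ₗ[k] k) (ha : ψ a = 1)
    (h₁ : ∀ α : r ⟶ r', M.act α a = v r' ∧ (φ r').comp (M.act α).hom = ψ)
    (h₂ : ∀ α : r' ⟶ r, M.act α (v r') = a ∧ ψ.comp (M.act α).hom = φ r') :
    ∃ S v φ, IsSplitting M {x | pos r ≤ pos x} S v φ ∧ IsInterval pos S ∧ r ∈ S ∧
      v r = a ∧ φ r = ψ := by
  have hne : ∀ {x}, pos r' ≤ pos x → x ≠ r := fun hx h => by subst h; omega
  have hSle : ∀ {x}, x ∈ S → pos r' ≤ pos x := fun hx => h.subset hx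
  have hcase : ∀ {x y : V}, (x ⟶ y) → pos r ≤ pos x → pos r ≤ pos y →
      (x = r ∧ y = r') ∨ (x = r' ∧ y = r) ∨ (pos r' ≤ pos x ∧ pos r' ≤ pos y) := by
    intro x y α hx hy
    have := hV.step α
    by_cases hxr : pos x = pos r
    · exact Or.inl ⟨hV.inj hxr, hV.inj (by omega)⟩
    by_cases hyr : pos y = pos r
    · exact Or.inr (Or.inl ⟨hV.inj (by omega), hV.inj hyr⟩)
    · exact Or.inr (Or.inr ⟨by omega, by omega⟩)
  refine ⟨insert r S, Function.update v r a, Function.update φ r ψ,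
    ⟨?_, ?_, ?_, ?_, ?_, ?_⟩, ?_, Or.inl rfl, Function.update_self .., Function.update_self ..⟩
  · rintro x (rfl | hx)
    · exact le_refl (pos x)
    · have := hSle hx
      change pos r ≤ pos x
      omega
  · rintro x (rfl | hx)
    · rwa [Function.update_self, Function.update_self]
    · rw [Function.update_of_ne (hne (hSle hx)), Function.update_of_ne (hne (hSle hx))]
      exact h.eq_one x hx
  · intro x hx
    rw [Function.update_of_ne fun h => hx (Or.inl h)]
    exact h.vec_eq_zero x fun h => hx (Or.inr h)
  · intro x hx
    rw [Function.update_of_ne fun h => hx (Or.inl h)]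
    exact h.dual_eq_zero x fun h => hx (Or.inr h)
  · intro x y α hx hy hxS
    rcases hcase α hx hy with ⟨rfl, rfl⟩ | ⟨rfl, rfl⟩ | ⟨hx', hy'⟩
    · rw [Function.update_self, Function.update_of_ne (hne le_rfl)]
      exact (h₁ α).1
    · rw [Function.update_self, Function.update_of_ne (hne le_rfl)]
      exact (h₂ α).1
    · rw [Function.update_of_ne (hne hx'), Function.update_of_ne (hne hy')]
      exact h.map_vec α hx' hy' (hxS.resolve_left (hne hx'))
  · intro x y α hx hy hyS
    rcases hcase α hx hy with ⟨rfl, rfl⟩ | ⟨rfl, rfl⟩ | ⟨hx', hy'⟩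
    · rw [Function.update_self, Function.update_of_ne (hne le_rfl)]
      exact (h₁ α).2
    · rw [Function.update_self, Function.update_of_ne (hne le_rfl)]
      exact (h₂ α).2
    · rw [Function.update_of_ne (hne hx'), Function.update_of_ne (hne hy')]
      exact h.comp_dual α hx' hy' (hyS.resolve_left (hne hy'))
  · have hSr : ∀ {y z : V}, z ∈ S → pos r ≤ pos y → pos y ≤ pos z → y ∈ insert r S := by
      intro y z hz h₁ h₂
      by_cases hy : pos y = pos r
      · exact Or.inl (hV.inj hy)
      · exact Or.inr (hS hrS hz (by omega) h₂)
    rintro x y z (rfl | hx) (rfl | hz) hxy hyz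
    · exact Or.inl (hV.inj (le_antisymm hyz hxy))
    · exact hSr hz hxy hyz
    · have := hSle hx
      omega
    · exact Or.inr (hS hx hz hxy hyz)

open scoped Classical in
/-- In the stable range every vector and functional with pairing one extend to splitting data. -/
theorem IsStableFrom.exists_isSplitting (hV : LinePos pos) {N : ℤ} (h : IsStableFrom pos M N)
    (r : V) (hr : N ≤ pos r) (a : M.space r) (ψ : M.space r →ₗ[k] k) (ha : ψ a = 1) :
    ∃ S v φ, IsSplitting M {x | pos r ≤ pos x} S v φ ∧ IsInterval pos S ∧ r ∈ S ∧
      v r = a ∧ φ r = ψ := by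
  have hiso : ∀ {x : V} (p : Quiver.Path r x), pos r ≤ pos x →
      IsIso (M.map (X := (Paths.of V).obj r) (Y := (Paths.of V).obj x) p) := by
    intro x p hx
    induction p with
    | nil => exact inferInstanceAs (IsIso (M.map (𝟙 ((Paths.of V).obj r))))
    | @cons c x p α ih =>
      have h₁ := hV.path_arrow p α
      have := ih (by omega)
      have := (h α).1 (by omega) (by omega)
      exact (M.map_comp (X := (Paths.of V).obj r) (Y := (Paths.of V).obj c)
        (Z := (Paths.of V).obj x) p ((Paths.of V).map α)) ▸ inferInstance
  -- The vector is transported along the outward isomorphisms and the functional along their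
  -- inverses. At the first inward arrow the data stop, since that arrow starts at a zero space.
  let S : Set V := {x ∈ reach r | pos r ≤ pos x}
  have hdata : ∀ x : V, ∃ (m : M.space x) (χ : M.space x →ₗ[k] k), (x ∉ S → m = 0 ∧ χ = 0) ∧
      ∀ p : Quiver.Path r x, x ∈ S →
        m = M.map (X := (Paths.of V).obj r) (Y := (Paths.of V).obj x) p a ∧
        χ.comp (M.map (X := (Paths.of V).obj r) (Y := (Paths.of V).obj x) p).hom = ψ := by
    intro x
    by_cases hx : x ∈ S
    · obtain ⟨⟨p⟩, hx'⟩ := hx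
      have := hiso p hx'
      refine ⟨M.map (X := (Paths.of V).obj r) (Y := (Paths.of V).obj x) p a,
        ψ.comp (inv (M.map (X := (Paths.of V).obj r) (Y := (Paths.of V).obj x) p)).hom,
        fun h => absurd ⟨⟨p⟩, hx'⟩ h, fun q _ => ?_⟩
      rw [(hV.subsingleton_path r x).elim q p]
      refine ⟨rfl, ?_⟩
      rw [LinearMap.comp_assoc, ← ModuleCat.hom_comp, IsIso.hom_inv_id]
      rfl
    · exact ⟨0, 0, fun _ => ⟨rfl, rfl⟩, fun _ h => absurd h hx⟩
  choose v φ h0 hp using hdata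
  have hrS : r ∈ S := ⟨self_mem_reach r, le_rfl⟩
  have hvr : v r = a := by
    refine (hp r Quiver.Path.nil hrS).1.trans ?_
    exact congrArg (fun f => f a) (M.map_id ((Paths.of V).obj r))
  have hφr : φ r = ψ := by
    refine Eq.trans ?_ (hp r Quiver.Path.nil hrS).2
    exact (congrArg (fun f => (φ r).comp f.hom) (M.map_id ((Paths.of V).obj r))).symm
  refine ⟨S, v, φ, ⟨fun x hx => hx.2, ?_, fun x hx => (h0 x hx).1, fun x hx => (h0 x hx).2,
    ?_, ?_⟩, ?_, hrS, hvr, hφr⟩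
  · intro x hx
    obtain ⟨p⟩ := hx.1
    rw [(hp x p hx).1]
    exact (LinearMap.congr_fun (hp x p hx).2 a).trans ha
  · intro x y α hx hy hxS
    obtain ⟨p⟩ := hxS.1
    rw [(hp x p hxS).1, (hp y (p.cons α) ⟨⟨p.cons α⟩, hy⟩).1]
    exact (congrArg (fun f => f a) (M.map_comp (X := (Paths.of V).obj r) (Y := (Paths.of V).obj x)
        (Z := (Paths.of V).obj y) p ((Paths.of V).map α))).symm
  · intro x y α hx hy hyS
    have hx : pos r ≤ pos x := hx
    have hy : pos r ≤ pos y := hy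
    rcases hV.step α with hxy | hxy
    · have hxS : x ∈ S := by
        refine ⟨?_, hx⟩
        obtain ⟨q⟩ := hyS.1
        cases q with
        | nil => omega
        | @cons c _ p β =>
          have := hV.path_arrow p β
          rw [hV.inj (show pos x = pos c by omega)]
          exact ⟨p⟩
      obtain ⟨p⟩ := hxS.1
      have := hiso p hx
      have h₁ := (hp y (p.cons α) hyS).2
      rw [← (hp x p hxS).2] at h₁
      have h₂ := M.map_comp (X := (Paths.of V).obj r) (Y := (Paths.of V).obj x)
        (Z := (Paths.of V).obj y) p ((Paths.of V).map α)
      have h₃ : ((φ y).comp (M.act α).hom).comp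
          (M.map (X := (Paths.of V).obj r) (Y := (Paths.of V).obj x) p).hom =
          (φ x).comp (M.map (X := (Paths.of V).obj r) (Y := (Paths.of V).obj x) p).hom := by
        refine Eq.trans ?_ h₁
        exact (congrArg (fun f => (φ y).comp f.hom) h₂).symm
      have hsurj : Function.Surjective
          (M.map (X := (Paths.of V).obj r) (Y := (Paths.of V).obj x) p).hom :=
        ((ConcreteCategory.isIso_iff_bijective _).1 this).2
      exact LinearMap.ext fun m => by
        obtain ⟨m, rfl⟩ := hsurj m
        exact LinearMap.congr_fun h₃ m
    · have := (ModuleCat.isZero_iff_subsingleton).1 ((h α).2 (by omega) hxy)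
      exact LinearMap.ext fun m => by
        rw [show m = 0 from Subsingleton.elim _ _, map_zero, map_zero]
  · have key : ∀ {y z : V} (p : Quiver.Path r z), pos r ≤ pos y → pos y ≤ pos z → y ∈ reach r := by
      intro y z p h₁ h₂
      induction p with
      | nil => rw [hV.inj (le_antisymm h₂ h₁)]; exact self_mem_reach _
      | @cons c z p α ih =>
        have := hV.path_arrow p α
        by_cases hyc : pos y ≤ pos c
        · exact ih hyc
        · rw [hV.inj (show pos y = pos z by omega)]
          exact ⟨p.cons α⟩
    rintro x y z ⟨-, hx⟩ ⟨⟨p⟩, -⟩ hxy hyz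
    have : pos r ≤ pos y := by omega
    exact ⟨key p this hyz, this⟩

theorem exists_dual_eq_one {E : Type*} [AddCommGroup E] [Module k E] {B : Submodule k E} {a : E}
    (ha : a ∉ B) : ∃ φ : E →ₗ[k] k, φ a = 1 ∧ ∀ b ∈ B, φ b = 0 := by
  obtain ⟨φ, h₁, h₂⟩ := LinearMap.exists_extend_of_notMem (0 : B →ₗ[k] k) ha 1
  exact ⟨φ, h₂, fun b hb => LinearMap.congr_fun h₁ ⟨b, hb⟩⟩

/-- The hypothesis says that `φ` kills the kernel of `E → F ⧸ B`, so it factors through this map. -/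
theorem exists_dual_comp_eq {E F : Type*} [AddCommGroup E] [Module k E] [AddCommGroup F]
    [Module k F] (f : E →ₗ[k] F) {B : Submodule k F} (φ : E →ₗ[k] k)
    (h : ∀ x, f x ∈ B → φ x = 0) : ∃ ψ : F →ₗ[k] k, ψ.comp f = φ ∧ ∀ b ∈ B, ψ b = 0 := by
  have hφ : φ ∈ LinearMap.range (B.mkQ.comp f).dualMap := by
    rw [LinearMap.range_dualMap_eq_dualAnnihilator_ker, Submodule.mem_dualAnnihilator]
    intro x hx
    refine h x ?_
    rwa [LinearMap.mem_ker, LinearMap.comp_apply, Submodule.mkQ_apply,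
      Submodule.Quotient.mk_eq_zero] at hx
  obtain ⟨ψ, hψ⟩ := hφ
  refine ⟨ψ.comp B.mkQ, hψ, fun b hb => ?_⟩
  rw [LinearMap.comp_apply, Submodule.mkQ_apply, (Submodule.Quotient.mk_eq_zero B).2 hb, map_zero]

/-- Given subspaces `B < A` of `M(r)`, there are splitting data to the right of `r` with vector in
`A` and functional vanishing on `B`. -/
theorem IsStableFrom.exists_isSplitting_of_lt (hV : LinePos pos) {N : ℤ}
    (h : IsStableFrom pos M N) (r : V) (A B : Submodule k (M.space r)) (hBA : B < A) :
    ∃ S v φ, IsSplitting M {x | pos r ≤ pos x} S v φ ∧ IsInterval pos S ∧ r ∈ S ∧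
      v r ∈ A ∧ ∀ b ∈ B, φ r b = 0 := by
  -- Induction on the distance to the stable range. Arbitrary pairs `B < A` are needed because the
  -- step to the next vertex replaces them by images or preimages.
  obtain ⟨n, hn⟩ : ∃ n : ℕ, N ≤ pos r + n := ⟨(N - pos r).toNat, by omega⟩
  induction n generalizing r with
  | zero =>
    obtain ⟨a, haA, haB⟩ := SetLike.exists_of_lt hBA
    obtain ⟨ψ, h₁, h₂⟩ := exists_dual_eq_one haB
    obtain ⟨S, v, φ, hs, hI, hr, hv, hφ⟩ := h.exists_isSplitting hV r (by simpa using hn) a ψ h₁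
    exact ⟨S, v, φ, hs, hI, hr, hv ▸ haA, hφ ▸ h₂⟩
  | succ n ih =>
    obtain ⟨hle, hnle⟩ := lt_iff_le_not_ge.1 hBA
    have conclude : ∀ (a : M.space r) (ψ : M.space r →ₗ[k] k), a ∈ A → (∀ b ∈ B, ψ b = 0) →
        ψ a = 1 →
        (∀ {y : V} (α : r ⟶ y), pos y = pos r + 1 → M.act α a = 0) →
        (∀ {y : V} (α : y ⟶ r), pos y = pos r + 1 → ψ.comp (M.act α).hom = 0) →
        ∃ S v φ, IsSplitting M {x | pos r ≤ pos x} S v φ ∧ IsInterval pos S ∧ r ∈ S ∧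
          v r ∈ A ∧ ∀ b ∈ B, φ r b = 0 := by
      intro a ψ haA hψ ha h₁ h₂
      obtain ⟨S, v, φ, hs, hI, hr, hv, hφ⟩ := exists_isSplitting_singleton hV r a ψ ha h₁ h₂
      exact ⟨S, v, φ, hs, hI, hr, hv ▸ haA, hφ ▸ hψ⟩
    by_cases hr : ∃ r', pos r' = pos r + 1
    · obtain ⟨r', hr'⟩ := hr
      have huniq : ∀ {y}, pos y = pos r + 1 → y = r' := fun hy => hV.inj (hy.trans hr'.symm)
      rcases hV.total hr' with ⟨⟨α⟩⟩ | ⟨⟨α⟩⟩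
      · by_cases hmap : A.map (M.act α).hom ≤ B.map (M.act α).hom
        -- When `A` and `B` have the same image, some vector of `A` outside `B` is killed by `α`,
        -- and the data can stop at `r`.
        · obtain ⟨a, haA, haB⟩ := SetLike.exists_of_lt hBA
          obtain ⟨b, hb, hab⟩ := hmap ⟨a, haA, rfl⟩
          have huB : a - b ∉ B := fun h => haB (by simpa using B.add_mem h hb)
          obtain ⟨ψ, h₁, h₂⟩ := exists_dual_eq_one huB
          refine conclude (a - b) ψ (A.sub_mem haA (hle hb)) h₂ h₁ ?_ ?_
          · intro y β hy
            obtain rfl := huniq hy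
            rw [(hV.subsingleton _ _).elim β α, map_sub]
            exact sub_eq_zero.2 hab.symm
          · intro y β hy
            obtain rfl := huniq hy
            exact (hV.antisymm α β).elim
        -- Otherwise continue with the images at `r'`, lift the vector back to `A`, and pull the
        -- functional back along `α`.
        · obtain ⟨S, v, φ, hs, hI, hrS, ⟨a, haA, hav⟩, hφ⟩ := ih r' _ _
            (lt_iff_le_not_ge.2 ⟨Submodule.map_mono hle, hmap⟩) (by push_cast at hn; omega)
          obtain ⟨S', v', φ', hs', hI', hr', hv', hφ'⟩ := hs.exists_insert hV hr' hI hrS a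
            ((φ r').comp (M.act α).hom)
            (by rw [LinearMap.comp_apply, hav]; exact hs.eq_one r' hrS)
            (fun β => by rw [(hV.subsingleton _ _).elim β α]; exact ⟨hav, rfl⟩)
            (fun β => (hV.antisymm α β).elim)
          refine ⟨S', v', φ', hs', hI', hr', hv' ▸ haA, fun b hb => ?_⟩
          rw [hφ']
          exact hφ _ ⟨b, hb, rfl⟩
      · by_cases hmap : A.comap (M.act α).hom ≤ B.comap (M.act α).hom
        -- When the preimages agree, `a` lies outside `B` plus the range of `α`, so some functional
        -- kills both and the data can stop at `r`.
        · obtain ⟨a, haA, haB⟩ := SetLike.exists_of_lt hBA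
          have haB' : a ∉ B ⊔ LinearMap.range (M.act α).hom := by
            intro ha
            obtain ⟨b, hb, _, ⟨t, rfl⟩, rfl⟩ := Submodule.mem_sup.1 ha
            have ht : (M.act α).hom t ∈ B := hmap (by
              change (M.act α).hom t ∈ A
              simpa using A.sub_mem haA (hle hb))
            exact haB (B.add_mem hb ht)
          obtain ⟨ψ, h₁, h₂⟩ := exists_dual_eq_one haB'
          refine conclude a ψ haA (fun b hb => h₂ b (Submodule.mem_sup_left hb)) h₁ ?_ ?_
          · intro y β hy
            obtain rfl := huniq hy
            exact (hV.antisymm α β).elim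
          · intro y β hy
            obtain rfl := huniq hy
            rw [(hV.subsingleton _ _).elim β α]
            exact LinearMap.ext fun t => h₂ _ (Submodule.mem_sup_right ⟨t, rfl⟩)
        -- Otherwise continue with the preimages at `r'` and push the vector forward; the functional
        -- extends along `α`, still killing `B`, because `φ r'` kills the preimage of `B`.
        · obtain ⟨S, v, φ, hs, hI, hrS, hvA, hφ⟩ := ih r' _ _
            (lt_iff_le_not_ge.2 ⟨Submodule.comap_mono hle, hmap⟩) (by push_cast at hn; omega)
          obtain ⟨ψ, hψ₁, hψ₂⟩ := exists_dual_comp_eq (M.act α).hom (φ r') hφ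
          obtain ⟨S', v', φ', hs', hI', hr', hv', hφ'⟩ := hs.exists_insert hV hr' hI hrS
            (M.act α (v r')) ψ
            ((LinearMap.congr_fun hψ₁ (v r')).trans (hs.eq_one r' hrS))
            (fun β => (hV.antisymm α β).elim)
            (fun β => by rw [(hV.subsingleton _ _).elim β α]; exact ⟨rfl, hψ₁⟩)
          exact ⟨S', v', φ', hs', hI', hr', hv' ▸ hvA, hφ' ▸ hψ₂⟩
    · obtain ⟨a, haA, haB⟩ := SetLike.exists_of_lt hBA
      obtain ⟨ψ, h₁, h₂⟩ := exists_dual_eq_one haB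
      exact conclude a ψ haA h₂ h₁ (fun _ hy => absurd ⟨_, hy⟩ hr) (fun _ hy => absurd ⟨_, hy⟩ hr)

open scoped Classical in
/-- Splitting data to the right and to the left of a vertex can be glued. -/
theorem IsSplitting.exists_glue (hV : LinePos pos) (r : V) {S T : Set V} {v u : ∀ x, M.space x}
    {φ ψ : ∀ x, M.space x →ₗ[k] k} (h : IsSplitting M {x | pos r ≤ pos x} S v φ)
    (hS : IsInterval pos S) (hrS : r ∈ S) (h' : IsSplitting M {x | - pos r ≤ - pos x} T u ψ)
    (hT : IsInterval pos T) (hrT : r ∈ T) (hv : u r = v r) (hφ : ψ r = φ r) :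
    ∃ S v φ, IsSplitting M Set.univ S v φ ∧ IsInterval pos S ∧ S.Nonempty := by
  have hST : ∀ {x}, pos r ≤ pos x → (x ∈ S ∪ T ↔ x ∈ S) := by
    intro x hx
    refine ⟨?_, Or.inl⟩
    rintro (h | h)
    · exact h
    · have : - pos r ≤ - pos x := h'.subset h
      rwa [hV.inj (show pos x = pos r by omega)]
  have hTS : ∀ {x}, pos x ≤ pos r → (x ∈ S ∪ T ↔ x ∈ T) := by
    intro x hx
    refine ⟨?_, Or.inr⟩
    rintro (h₁ | h₁)
    · have : pos r ≤ pos x := h.subset h₁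
      rwa [hV.inj (show pos x = pos r by omega)]
    · exact h₁
  let v' : ∀ x, M.space x := fun x => if pos r ≤ pos x then v x else u x
  let φ' : ∀ x, M.space x →ₗ[k] k := fun x => if pos r ≤ pos x then φ x else ψ x
  have hv₁ : ∀ {x}, pos r ≤ pos x → v' x = v x := fun hx => if_pos hx
  have hφ₁ : ∀ {x}, pos r ≤ pos x → φ' x = φ x := fun hx => if_pos hx
  have hv₂ : ∀ {x}, pos x ≤ pos r → v' x = u x := by
    intro x hx
    by_cases hx' : pos r ≤ pos x
    · obtain rfl : x = r := hV.inj (le_antisymm hx hx')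
      exact (hv₁ hx').trans hv.symm
    · exact if_neg hx'
  have hφ₂ : ∀ {x}, pos x ≤ pos r → φ' x = ψ x := by
    intro x hx
    by_cases hx' : pos r ≤ pos x
    · obtain rfl : x = r := hV.inj (le_antisymm hx hx')
      exact (hφ₁ hx').trans hφ.symm
    · exact if_neg hx'
  have hcase : ∀ {x y : V}, (x ⟶ y) →
      (pos r ≤ pos x ∧ pos r ≤ pos y) ∨ (pos x ≤ pos r ∧ pos y ≤ pos r) := by
    intro x y α
    have := hV.step α
    omega
  refine ⟨S ∪ T, v', φ', ⟨Set.subset_univ _, ?_, ?_, ?_, ?_, ?_⟩, ?_, r, Or.inl hrS⟩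
  · intro x hx
    rcases le_total (pos r) (pos x) with h₁ | h₁
    · rw [hv₁ h₁, hφ₁ h₁]
      exact h.eq_one x ((hST h₁).1 hx)
    · rw [hv₂ h₁, hφ₂ h₁]
      exact h'.eq_one x ((hTS h₁).1 hx)
  · intro x hx
    rcases le_total (pos r) (pos x) with h₁ | h₁
    · rw [hv₁ h₁]
      exact h.vec_eq_zero x fun h => hx (Or.inl h)
    · rw [hv₂ h₁]
      exact h'.vec_eq_zero x fun h => hx (Or.inr h)
  · intro x hx
    rcases le_total (pos r) (pos x) with h₁ | h₁
    · rw [hφ₁ h₁]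
      exact h.dual_eq_zero x fun h => hx (Or.inl h)
    · rw [hφ₂ h₁]
      exact h'.dual_eq_zero x fun h => hx (Or.inr h)
  · intro x y α _ _ hx
    rcases hcase α with ⟨h₁, h₂⟩ | ⟨h₁, h₂⟩
    · rw [hv₁ h₁, hv₁ h₂]
      exact h.map_vec α h₁ h₂ ((hST h₁).1 hx)
    · rw [hv₂ h₁, hv₂ h₂]
      exact h'.map_vec α (neg_le_neg h₁) (neg_le_neg h₂) ((hTS h₁).1 hx)
  · intro x y α _ _ hy
    rcases hcase α with ⟨h₁, h₂⟩ | ⟨h₁, h₂⟩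
    · rw [hφ₁ h₁, hφ₁ h₂]
      exact h.comp_dual α h₁ h₂ ((hST h₂).1 hy)
    · rw [hφ₂ h₁, hφ₂ h₂]
      exact h'.comp_dual α (neg_le_neg h₁) (neg_le_neg h₂) ((hTS h₂).1 hy)
  · intro x y z hx hz hxy hyz
    rcases le_total (pos r) (pos y) with h₁ | h₁
    · exact Or.inl (hS hrS ((hST (h₁.trans hyz)).1 hz) h₁ hyz)
    · exact Or.inr (hT ((hTS (hxy.trans h₁)).1 hx) hrT hxy h₁)

/-- The vertex `r` is chosen so that any vector and functional of pairing one extend to its left.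
The data to its right, built from the pair `⊥ < ⊤`, can then be matched at `r` and glued. -/
theorem exists_isSplitting_univ (hV : LinePos pos) {N N' : ℤ} (h : IsStableFrom pos M N)
    (h' : IsStableFrom (fun x => - pos x) M N') (hM : ¬ IsZero M) :
    ∃ S v φ, IsSplitting M Set.univ S v φ ∧ IsInterval pos S ∧ S.Nonempty := by
  obtain ⟨r, hr, hleft⟩ : ∃ r, ¬ IsZero (M.space r) ∧ ∀ (a : M.space r) (ψ : M.space r →ₗ[k] k),
      ψ a = 1 → ∃ S v φ, IsSplitting M {x | - pos r ≤ - pos x} S v φ ∧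
        IsInterval (fun x => - pos x) S ∧ r ∈ S ∧ v r = a ∧ φ r = ψ := by
    by_cases hx : ∃ r, ¬ IsZero (M.space r) ∧ N' ≤ - pos r
    · obtain ⟨r, hr, hN'⟩ := hx
      exact ⟨r, hr, fun a ψ ha => h'.exists_isSplitting hV.neg r hN' a ψ ha⟩
    -- With no nonzero space in the left stable range, the support of `M` has a leftmost vertex;
    -- take it as `r`, and nothing has to be extended to the left.
    · have hex : ∃ n, ∃ r, ¬ IsZero (M.space r) ∧ pos r = n := by
        by_contra! hc
        refine hM ((Functor.isZero_iff _).2 fun x => ?_)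
        by_contra hx
        exact hc _ x hx rfl
      obtain ⟨n, ⟨r, hr, rfl⟩, hmin⟩ := Int.exists_least_of_bdd (P := fun n =>
        ∃ r, ¬ IsZero (M.space r) ∧ pos r = n) ⟨- N', by
          rintro _ ⟨r, hr, rfl⟩
          by_contra hn
          exact hx ⟨r, hr, by omega⟩⟩ hex
      have hzero : ∀ {y}, - pos y = - pos r + 1 → IsZero (M.space y) := by
        intro y hy
        by_contra hy'
        have := hmin _ ⟨y, hy', rfl⟩
        omega
      refine ⟨r, hr, fun a ψ ha => exists_isSplitting_singleton hV.neg r a ψ ha ?_ ?_⟩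
      · intro y α hy
        have := ModuleCat.isZero_iff_subsingleton.1 (hzero hy)
        exact Subsingleton.elim _ _
      · intro y α hy
        have := ModuleCat.isZero_iff_subsingleton.1 (hzero hy)
        exact LinearMap.ext fun m => by
          rw [show m = 0 from Subsingleton.elim _ _, map_zero, map_zero]
  rw [ModuleCat.isZero_iff_subsingleton, not_subsingleton_iff_nontrivial] at hr
  obtain ⟨S, v, φ, hs, hI, hrS, -, -⟩ := h.exists_isSplitting_of_lt hV r ⊤ ⊥ bot_lt_top
  obtain ⟨T, u, ψ, hs', hI', hrT, hv, hφ⟩ := hleft (v r) (φ r) (hs.eq_one r hrS)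
  have hI'' : IsInterval pos T := fun {_ _ _} hx hz hxy hyz =>
    hI' hz hx (neg_le_neg hyz) (neg_le_neg hxy)
  exact hs.exists_glue hV r hI hrS hs' hI'' hrT hv hφ

end Split

end QuiverRep

/-! ### The main theorem. -/

theorem proposition5p1 {k : Type w} [Field k] {V : Type u} [Quiver.{v} V]
    (hQ : QuiverRep.IsTypeAInfInf V ∨ QuiverRep.IsTypeAInf V)
    (M : QuiverRep.Representation k V)
    (hfin : QuiverRep.IsLocallyFiniteDimensional M)
    (hind : CategoryTheory.Indecomposable M) :
    QuiverRep.IsFinitelyPresented M ↔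
      ∃ p : QuiverRep.Walk V, p.IsString ∧ ¬ QuiverRep.HasLeftInfinitePath p.verts ∧
        Nonempty (M ≅ QuiverRep.stringRep k p) := by
  obtain ⟨pos, hV⟩ := QuiverRep.exists_linePos hQ
  constructor
  · intro hM
    obtain ⟨N, hN⟩ := hM.exists_isStableFrom hV
    obtain ⟨N', hN'⟩ := hM.exists_isStableFrom hV.neg
    obtain ⟨S, v, φ, hs, hI, a, ha⟩ := QuiverRep.exists_isSplitting_univ hV hN hN' hind.1
    obtain ⟨f, g, hfg⟩ := hs.exists_retract
    obtain ⟨e⟩ := QuiverRep.nonempty_iso_of_retract hind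
      (fun h => QuiverRep.not_isZero_ind (k := k) ha ((Functor.isZero_iff _).1 h _)) f g hfg
    have hS : QuiverRep.IsStableFrom pos (QuiverRep.ind k S) N := QuiverRep.IsStableFrom.of_iso hN e
    have hS' : QuiverRep.IsStableFrom (fun x => - pos x) (QuiverRep.ind k S) N' :=
      QuiverRep.IsStableFrom.of_iso hN' e
    obtain ⟨p, hp, rfl⟩ := hV.exists_walk hI ⟨a, ha⟩
    have hpath := QuiverRep.not_hasLeftInfinitePath hV hS hS'
    obtain ⟨x, hx⟩ := QuiverRep.exists_isSourceIn ⟨a, ha⟩ hpath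
    obtain ⟨e'⟩ := hV.nonempty_stringRep_iso k hp
    exact ⟨p, ⟨hp, ⟨x, Or.inr hx⟩, QuiverRep.finite_sinks_sources hV hI hS hS'⟩, hpath,
      ⟨e ≪≫ e'.symm⟩⟩
  · rintro ⟨p, ⟨hp, -, hfin'⟩, hpath, ⟨e⟩⟩
    obtain ⟨e'⟩ := hV.nonempty_stringRep_iso k hp
    exact (QuiverRep.isFinitelyPresented_ind hV (hV.verts_isInterval hp) hfin' hpath).of_iso
      (e ≪≫ e').symm
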